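/- Let $S_n$ be the group of permutations of $\{1,\dots,n\}$ with simple generators $s_i=(i\;i+1)$, $1\le i<n$, and Coxeter length $\ell$. Right weak order $\leq_R$ is the partial order on $S_n$ generated by the relations $u<us$ with $s$ a simple generator and $\ell(us)=\ell(u)+1$; Bruhat order $\preceq$ is generated by the relations $u\prec ut$ with $t$ a transposition and $\ell(ut)=\ell(u)+1$. For $u\in S_n$ put $\boldsymbol u=(u^{-1}(1),\dots,u^{-1}(n))\in\mathbb R^n$. For $w\in S_n$ let $Q_w=\operatorname{conv}\{\boldsymbol u\mid u\preceq w\}$ be the Bruhat interval polytope, and let $P_w$ be its 1-skeleton poset: the set $[e,w]=\{u\mid u\preceq w\}$ with the partial order $\leq_w$ generated by the relations $u<_w v$ whenever $Q_w$ has an edge between $\boldsymbol u$ and $\boldsymbol v$ and $\ell(u)<\ell(v)$. For $y\in S_n$ let $C(y)$ be the cone of all $x\in\mathbb R^n$ with $x_{y(1)}\le x_{y(2)}\le\dots\le x_{y(n)}$, and for $u\preceq w$ let $C_w(u)$ be the cone of all $x\in\mathbb R^n$ such that $\langle x,\cdot\rangle$ attains its maximum over $Q_w$ at $\boldsymbol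 u$. Let $\Theta_w$ be the equivalence relation on $S_n$ in which $y$ and $z$ are equivalent if and only if $C(y)$ and $C(z)$ are contained in the same cones among the $C_w(u)$, $u\preceq w$, and let $[x]_w$ be the class of $x$. **Theorem.** Let $w\in S_n$. Every class $[x]_w$ has a minimum $\mathrm{Bot}_w(x)$ and a maximum $\mathrm{Top}_w(x)$ with respect to $\leq_R$, any two elements $x,y\in S_n$ have a join $x\vee_R y$ in right weak order, and the poset $P_w$ is a lattice whose join operation is $$u\vee_w v=\mathrm{Bot}_w\bigl(\mathrm{Top}_w(u)\vee_R\mathrm{Top}_w(v)\bigr)\qquad(u,v\in[e,w]).$$ In particular, $P_w$ is a lattice for every Grassmannian permutation $w$ (one with at most one descent), as conjectured by Fraser. -/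

import Mathlib

namespace BruhatPolytope

open Equiv

variable {n : ℕ}

/-- The simple generators `s_i = (i i+1)` of `S_n`, the group of permutations of `Fin n`. -/
def IsSimpleReflection (s : Perm (Fin n)) : Prop :=
  ∃ i j : Fin n, (j : ℕ) = (i : ℕ) + 1 ∧ s = swap i j

/-- Coxeter length: the least number of factors in an expression of `w` as a product of simple
generators (such expressions exist, since the simple generators are involutions generating
`S_n`). -/
noncomputable def length (w : Perm (Fin n)) : ℕ :=
  sInf {k : ℕ | ∃ l : List (Perm (Fin n)),
    (∀ s ∈ l, IsSimpleReflection s) ∧ l.prod = w ∧ l.length = k}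

/-- `v = u s` with `s` a simple generator and `ℓ(v) = ℓ(u) + 1`. -/
def RightWeakCover (u v : Perm (Fin n)) : Prop :=
  ∃ s : Perm (Fin n), IsSimpleReflection s ∧ v = u * s ∧ length v = length u + 1

/-- The right weak order `u ≤_R v`. -/
def RightWeakLE : Perm (Fin n) → Perm (Fin n) → Prop :=
  Relation.ReflTransGen RightWeakCover

/-- `v = u t` with `t` a transposition and `ℓ(v) = ℓ(u) + 1`. -/
def BruhatCover (u v : Perm (Fin n)) : Prop :=
  ∃ t : Perm (Fin n), t.IsSwap ∧ v = u * t ∧ length v = length u + 1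

/-- The (strong) Bruhat order. -/
def BruhatLE : Perm (Fin n) → Perm (Fin n) → Prop :=
  Relation.ReflTransGen BruhatCover

/-- The vector `(w⁻¹(1), …, w⁻¹(n))` of `ℝⁿ`. Since `Fin n` is `{0, …, n-1}`, values are shifted
by one. -/
def vec (w : Perm (Fin n)) : Fin n → ℝ :=
  fun i => ((w⁻¹ i : Fin n) : ℝ) + 1

/-- The Bruhat interval polytope `Q_w`. -/
def polytope (w : Perm (Fin n)) : Set (Fin n → ℝ) :=
  convexHull ℝ {x | ∃ u, BruhatLE u w ∧ x = vec u}

/-- `Q_w` has an edge with (distinct) endpoints `vec u` and `vec v`: the segment between them is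
a face of `Q_w`, i.e. the set of maximizers over `Q_w` of some linear functional. -/
def HasEdge (w u v : Perm (Fin n)) : Prop :=
  vec u ≠ vec v ∧ IsExposed ℝ (polytope w) (segment ℝ (vec u) (vec v))

/-- The underlying set `[e, w]` of the 1-skeleton poset `P_w`. -/
def SkeletonPoset (w : Perm (Fin n)) : Type :=
  {u : Perm (Fin n) // BruhatLE u w}

/-- The generating relations of `P_w`: edges of `Q_w`, directed by increasing length. -/
def SkeletonCover (w : Perm (Fin n)) (u v : SkeletonPoset w) : Prop :=
  HasEdge w u.1 v.1 ∧ length u.1 < length v.1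

theorem eq_or_length_lt (w : Perm (Fin n)) {u v : SkeletonPoset w}
    (h : Relation.ReflTransGen (SkeletonCover w) u v) : u = v ∨ length u.1 < length v.1 := by
  induction h with
  | refl => exact Or.inl rfl
  | tail _ hc ih =>
    rcases ih with rfl | ih
    · exact Or.inr hc.2
    · exact Or.inr (ih.trans hc.2)

/-- The order `≤_w` of the 1-skeleton poset `P_w`. -/
instance skeletonPartialOrder (w : Perm (Fin n)) : PartialOrder (SkeletonPoset w) where
  le := Relation.ReflTransGen (SkeletonCover w)
  le_refl _ := Relation.ReflTransGen.refl
  le_trans _ _ _ := Relation.ReflTransGen.trans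
  le_antisymm u v huv hvu := by
    rcases eq_or_length_lt w huv with h | h
    · exact h
    · rcases eq_or_length_lt w hvu with h' | h'
      · exact h'.symm
      · exact absurd h (Nat.lt_asymm h')

/-- The top-dimensional cone `C(y)` of the braid fan: the points whose coordinates are in the
same relative order as those of `vec y`. -/
def braidCone (y : Perm (Fin n)) : Set (Fin n → ℝ) :=
  {x | ∀ i j : Fin n, vec y i < vec y j → x i ≤ x j}

/-- The cone `C_w(u)` of the normal fan of `Q_w` at the vertex `vec u`: the vectors `x` such that
the linear functional `⟨x, ·⟩` attains its maximum over `Q_w` at `vec u`. -/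
def normalCone (w u : Perm (Fin n)) : Set (Fin n → ℝ) :=
  {x | ∀ p ∈ polytope w, x ⬝ᵥ p ≤ x ⬝ᵥ vec u}

/-- The equivalence relation `Θ_w` on `S_n`: `y` and `z` are equivalent when the cones `C(y)` and
`C(z)` of the braid fan lie in the same top-dimensional cone of the normal fan of `Q_w`. -/
def Theta (w : Perm (Fin n)) : Setoid (Perm (Fin n)) where
  r y z := ∀ u : Perm (Fin n), BruhatLE u w →
    (braidCone y ⊆ normalCone w u ↔ braidCone z ⊆ normalCone w u)
  iseqv :=
    { refl := fun _ _ _ => Iff.rfl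
      symm := fun h u hu => (h u hu).symm
      trans := fun h h' u hu => (h u hu).trans (h' u hu) }

/-- `b` is the minimum of the class `[x]_w` in right weak order. -/
def IsBot (w x b : Perm (Fin n)) : Prop :=
  Theta w x b ∧ ∀ y, Theta w x y → RightWeakLE b y

/-- `t` is the maximum of the class `[x]_w` in right weak order. -/
def IsTop (w x t : Perm (Fin n)) : Prop :=
  Theta w x t ∧ ∀ y, Theta w x y → RightWeakLE y t

/-- `z` is the least upper bound of `x` and `y` in right weak order. -/
def IsRightWeakJoin (x y z : Perm (Fin n)) : Prop :=
  RightWeakLE x z ∧ RightWeakLE y z ∧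
    ∀ z', RightWeakLE x z' → RightWeakLE y z' → RightWeakLE z z'

/-- `Bot_w(x)`, the minimum of `[x]_w` in right weak order. -/
noncomputable def Bot (w x : Perm (Fin n)) : Perm (Fin n) :=
  Classical.epsilon (IsBot w x)

/-- `Top_w(x)`, the maximum of `[x]_w` in right weak order. -/
noncomputable def Top (w x : Perm (Fin n)) : Perm (Fin n) :=
  Classical.epsilon (IsTop w x)

/-- The join `x ∨_R y` in right weak order. -/
noncomputable def rightWeakJoin (x y : Perm (Fin n)) : Perm (Fin n) :=
  Classical.epsilon (IsRightWeakJoin x y)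

end BruhatPolytope

namespace BruhatPolytope

open Equiv

variable {n : ℕ}

/-! Every chamber of the braid fan lies in exactly one cone `C_w(u)` (`exists_braidCone_subset`,
`eq_of_braidCone_subset`). This gives a map `vertex w` from `S_n` onto `[e, w]` whose fibres are the
classes of `Θ_w`. The poset `P_w` is an order retract of the weak order: `vertex w` and `Top w` are
monotone and `vertex w (Top w u) = u`. A retract of a lattice is a lattice, whose join is the image
of the join of the two lifts; as `Bot w x` is `vertex w x`, this is the stated formula.

The chambers in `C_w(u)` are the linear extensions of the order generated by `Step w u`
(`braidCone_subset_iff`). Every inversion of `u` is a step read backwards, so `u` is the minimum of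
its class. The maximum inverts every pair `i < j` in which `i` is not forced before `j`; by
`Step.split` these pairs are closed and co-closed, hence form an inversion set (`exists_top`).

Edges of `Q_w` come from walls of the braid fan that separate two normal cones, and going up in
length along the edge is crossing the wall up in weak order (`hasEdge_of_wall`,
`exists_wall_of_hasEdge`). So `vertex w` is monotone. For `Top w`, let an edge from `u` to `v` cross
the wall from `y` to `y s`: the join of `Top w u` with `y s` still lies in the class of `v`
(`exists_rightWeakLE_of_wall`). -/

theorem apply_inv_apply (y : Perm (Fin n)) (i : Fin n) : y (y⁻¹ i) = i := y.apply_symm_apply i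

theorem inv_apply_apply (y : Perm (Fin n)) (i : Fin n) : y⁻¹ (y i) = i := y.symm_apply_apply i

/-! ### Inversions and Coxeter length -/

/-- The pair of values `i < j` is an inversion of `y`: `j` stands to the left of `i`. -/
def Inverts (y : Perm (Fin n)) (i j : Fin n) : Prop :=
  i < j ∧ y⁻¹ j < y⁻¹ i

theorem not_inverts {y : Perm (Fin n)} {i j : Fin n} (hij : i < j) :
    ¬ Inverts y i j ↔ y⁻¹ i < y⁻¹ j := by
  have : y⁻¹ i ≠ y⁻¹ j := fun h => hij.ne (y⁻¹.injective h)
  unfold Inverts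
  constructor
  · intro h
    by_contra h'
    exact h ⟨hij, lt_of_le_of_ne (not_lt.1 h') this.symm⟩
  · rintro h ⟨-, hji⟩
    exact lt_asymm h hji

/-- A nontrivial permutation has a descent at neighbouring positions. -/
theorem exists_adjacent_descent {σ : Perm (Fin n)} (h : σ ≠ 1) :
    ∃ k k' : Fin n, (k' : ℕ) = k + 1 ∧ σ k' < σ k := by
  by_contra! hc
  apply h
  obtain _ | m := n
  · exact Subsingleton.elim _ _
  have hm : StrictMono σ := by
    rw [Fin.strictMono_iff_lt_succ]
    intro i
    refine lt_of_le_of_ne (hc i.castSucc i.succ (by simp)) fun e => ?_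
    exact (Fin.castSucc_lt_succ (i := i)).ne (σ.injective e)
  have : (σ : Fin (m+1) → Fin (m+1)) = id :=
    (StrictMono.range_inj hm strictMono_id).1 (by simp [σ.surjective.range_eq])
  ext i
  simp [this]

theorem swap_adjacent_lt {k k' p q : Fin n} (hk : (k' : ℕ) = k + 1) (hpq : p < q)
    (hne : ¬ (p = k ∧ q = k')) : swap k k' p < swap k k' q := by
  have hkk : k ≠ k' := fun e => by simp [e] at hk
  simp only [swap_apply_def, Fin.lt_def, Fin.ext_iff] at *
  split_ifs <;> omega

theorem inverts_mul_swap {u : Perm (Fin n)} {k k' : Fin n} (hk : (k' : ℕ) = k + 1)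
    (hu : u k < u k') (i j : Fin n) :
    Inverts (u * swap k k') i j ↔ Inverts u i j ∨ (i = u k ∧ j = u k') := by
  have hkk : k < k' := by rw [Fin.lt_def]; omega
  obtain ⟨p, rfl⟩ := u.surjective i
  obtain ⟨q, rfl⟩ := u.surjective j
  simp only [Inverts, mul_inv_rev, swap_inv, Perm.mul_apply, inv_apply_apply,
    u.injective.eq_iff]
  constructor
  · rintro ⟨h1, h2⟩
    by_cases hc : p = k ∧ q = k'
    · exact Or.inr hc
    refine Or.inl ⟨h1, ?_⟩
    rcases lt_trichotomy p q with h | h | h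
    · exact absurd (swap_adjacent_lt hk h hc) (lt_asymm h2)
    · simp [h] at h1
    · exact h
  · rintro (⟨h1, h2⟩ | ⟨rfl, rfl⟩)
    · refine ⟨h1, swap_adjacent_lt hk h2 ?_⟩
      rintro ⟨rfl, rfl⟩
      exact lt_asymm h1 hu
    · simpa using ⟨hu, hkk⟩

open Classical in
/-- The number of inversions. -/
noncomputable def numInv (y : Perm (Fin n)) : ℕ :=
  (Finset.univ.filter fun p : Fin n × Fin n => Inverts y p.1 p.2).card

theorem numInv_mul_swap {u : Perm (Fin n)} {k k' : Fin n} (hk : (k' : ℕ) = k + 1)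
    (hu : u k < u k') : numInv (u * swap k k') = numInv u + 1 := by
  classical
  unfold numInv
  rw [← Finset.card_insert_of_notMem (a := (u k, u k'))]
  · congr 1
    ext ⟨i, j⟩
    simp only [Finset.mem_filter, Finset.mem_univ, true_and, Finset.mem_insert, Prod.mk.injEq,
      inverts_mul_swap hk hu]
    tauto
  · rw [Finset.mem_filter]
    rintro ⟨-, -, h⟩
    simp only [inv_apply_apply, Fin.lt_def] at h
    omega

theorem numInv_mul_swap_of_gt {u : Perm (Fin n)} {k k' : Fin n} (hk : (k' : ℕ) = k + 1)
    (hu : u k' < u k) : numInv u = numInv (u * swap k k') + 1 := by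
  have := numInv_mul_swap (u := u * swap k k') hk (by simpa using hu)
  rwa [mul_assoc, swap_mul_self, mul_one] at this

theorem ne_of_adjacent {k k' : Fin n} (hk : (k' : ℕ) = k + 1) : k ≠ k' :=
  fun e => by simp [e] at hk

theorem numInv_one : numInv (1 : Perm (Fin n)) = 0 := by
  classical
  rw [numInv, Finset.card_eq_zero, Finset.filter_eq_empty_iff]
  rintro ⟨i, j⟩ - ⟨h1, h2⟩
  exact lt_asymm h1 (by simpa using h2)

theorem numInv_prod_le (l : List (Perm (Fin n))) (hl : ∀ s ∈ l, IsSimpleReflection s) :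
    numInv l.prod ≤ l.length := by
  induction l using List.reverseRecOn with
  | nil => simp [numInv_one]
  | append_singleton l s ih =>
    have ih := ih fun s hs => hl s (by simp [hs])
    obtain ⟨k, k', hk, rfl⟩ := hl s (by simp)
    simp only [List.prod_append, List.prod_singleton, List.length_append, List.length_singleton]
    rcases lt_or_gt_of_ne (l.prod.injective.ne (ne_of_adjacent hk)) with h | h
    · rw [numInv_mul_swap hk h]
      omega
    · have := numInv_mul_swap_of_gt hk h
      omega

theorem exists_word (m : ℕ) : ∀ u : Perm (Fin n), numInv u = m →
    ∃ l : List (Perm (Fin n)), (∀ s ∈ l, IsSimpleReflection s) ∧ l.prod = u ∧ l.length = m := by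
  induction m with
  | zero =>
    intro u hu
    refine ⟨[], by simp, ?_, rfl⟩
    by_contra h
    obtain ⟨k, k', hk, hd⟩ := exists_adjacent_descent (Ne.symm h)
    have := numInv_mul_swap_of_gt hk hd
    omega
  | succ m ih =>
    intro u hu
    have h : u ≠ 1 := by
      rintro rfl
      rw [numInv_one] at hu
      omega
    obtain ⟨k, k', hk, hd⟩ := exists_adjacent_descent h
    have := numInv_mul_swap_of_gt hk hd
    obtain ⟨l, hl, hp, hlen⟩ := ih (u * swap k k') (by omega)
    refine ⟨l ++ [swap k k'], ?_, ?_, by simp [hlen]⟩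
    · intro s hs
      rcases List.mem_append.1 hs with hs | hs
      · exact hl s hs
      · exact ⟨k, k', hk, by simpa using hs⟩
    · simp [hp, mul_assoc]

/-- Right multiplication by a simple generator changes the number of inversions by exactly one, and
only the identity lacks an adjacent descent, so sorting yields a word of that length. -/
theorem length_eq_numInv (u : Perm (Fin n)) : length u = numInv u := by
  apply le_antisymm
  · exact Nat.sInf_le (exists_word _ u rfl)
  · have hne : {k : ℕ | ∃ l : List (Perm (Fin n)),
        (∀ s ∈ l, IsSimpleReflection s) ∧ l.prod = u ∧ l.length = k}.Nonempty :=
      ⟨_, exists_word _ u rfl⟩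
    obtain ⟨l, hl, hp, hlen⟩ := Nat.sInf_mem hne
    have := numInv_prod_le l hl
    rw [hp, hlen] at this
    exact this

theorem length_mul_swap {u : Perm (Fin n)} {k k' : Fin n} (hk : (k' : ℕ) = k + 1)
    (hu : u k < u k') : length (u * swap k k') = length u + 1 := by
  simp only [length_eq_numInv, numInv_mul_swap hk hu]

theorem length_mul_swap_of_gt {u : Perm (Fin n)} {k k' : Fin n} (hk : (k' : ℕ) = k + 1)
    (hu : u k' < u k) : length u = length (u * swap k k') + 1 := by
  simp only [length_eq_numInv, ← numInv_mul_swap_of_gt hk hu]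

/-! ### Bruhat order: transpositions and lifting -/

theorem swap_mul_swap_rotate {p m q : Fin n} (hmq : m ≠ q) (hpq : p ≠ q) :
    swap p q * swap p m = swap p m * swap m q := by
  rw [swap_mul_eq_mul_swap, swap_inv, swap_apply_left,
    swap_apply_of_ne_of_ne hpq.symm hmq.symm]

/-- A transposition of two values with no intermediate value in between changes the length
by one. -/
theorem length_mul_swap_of_empty (d : ℕ) : ∀ (u : Perm (Fin n)) (p q : Fin n),
    (q : ℕ) = p + 1 + d → u p < u q → (∀ m, p < m → m < q → u m < u p ∨ u q < u m) →
    length (u * swap p q) = length u + 1 := by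
  induction d with
  | zero =>
    intro u p q hq hu _
    exact length_mul_swap hq hu
  | succ d ih =>
    intro u p q hq hu hm
    obtain ⟨m, hpm⟩ : ∃ m : Fin n, (m : ℕ) = p + 1 := ⟨⟨p + 1, by omega⟩, rfl⟩
    have h1 : p < m := by rw [Fin.lt_def]; omega
    have h2 : m < q := by rw [Fin.lt_def]; omega
    -- With `m = p + 1`, the induction hypothesis treats `u * swap p m` and the shorter
    -- transposition of `m` and `q`. The simple factor `swap p m` changes both lengths in the same
    -- direction, because `u m` lies outside the interval between `u p` and `u q`.
    have hrot : u * swap p q * swap p m = u * swap p m * swap m q := by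
      rw [mul_assoc, swap_mul_swap_rotate h2.ne (h1.trans h2).ne, mul_assoc]
    have e1 : (u * swap p m) q = u q := by
      simp [swap_apply_of_ne_of_ne (h1.trans h2).ne' h2.ne']
    have e2 : (u * swap p q) m = u m := by
      simp [swap_apply_of_ne_of_ne h1.ne' h2.ne]
    have ih := ih (u * swap p m) m q (by omega) (by rw [e1]; simpa using hu) (by
      intro r hr hr'
      rw [e1, Perm.mul_apply, Perm.mul_apply, swap_apply_right,
        swap_apply_of_ne_of_ne (h1.trans hr).ne' hr.ne']
      exact hm r (h1.trans hr) hr')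
    rw [← hrot] at ih
    rcases hm m h1 h2 with h | h
    · have a := length_mul_swap_of_gt hpm h
      have b := length_mul_swap_of_gt (u := u * swap p q) hpm
        (by rw [e2]; simpa using h.trans hu)
      omega
    · have a := length_mul_swap hpm (hu.trans h)
      have b := length_mul_swap (u := u * swap p q) hpm
        (by rw [e2]; simpa using h)
      omega

theorem bruhatLE_mul_swap (d : ℕ) : ∀ (u : Perm (Fin n)) (p q : Fin n),
    (q : ℕ) ≤ p + d → p < q → u p < u q → BruhatLE u (u * swap p q) := by
  induction d with
  | zero =>
    intro u p q h1 h2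
    rw [Fin.lt_def] at h2
    omega
  | succ d ih =>
    intro u p q hd hpq hu
    by_cases hm : ∀ m, p < m → m < q → u m < u p ∨ u q < u m
    · refine Relation.ReflTransGen.single ⟨_, ⟨p, q, hpq.ne, rfl⟩, rfl, ?_⟩
      exact length_mul_swap_of_empty (q - p - 1) u p q (by rw [Fin.lt_def] at hpq; omega) hu hm
    -- An intermediate value at `m` factors `swap p q` as `swap p m * swap m q * swap p m`, and each
    -- of the three factors goes up.
    · push Not at hm
      obtain ⟨m, h1, h2, h3, h4⟩ := hm
      have h3 : u p < u m := lt_of_le_of_ne h3 (u.injective.ne h1.ne)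
      have h4 : u m < u q := lt_of_le_of_ne h4 (u.injective.ne h2.ne)
      have hp : p ≠ q := hpq.ne
      have a := ih u p m (by rw [Fin.lt_def] at h2; omega) h1 h3
      have b := ih (u * swap p m) m q (by rw [Fin.lt_def] at h1; omega) h2
        (by simpa [swap_apply_of_ne_of_ne hp.symm h2.ne'] using hu)
      have c := ih (u * swap p m * swap m q) p m (by rw [Fin.lt_def] at h2; omega) h1
        (by simpa [swap_apply_of_ne_of_ne hp.symm h2.ne', swap_apply_of_ne_of_ne h1.ne hp]
          using h4)
      have : u * swap p m * swap m q * swap p m = u * swap p q := by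
        rw [mul_assoc u, ← swap_mul_swap_rotate h2.ne hp, mul_assoc, mul_assoc,
          swap_mul_self, mul_one]
      rw [this] at c
      exact (a.trans b).trans c

theorem length_le_of_bruhatLE {u v : Perm (Fin n)} (h : BruhatLE u v) :
    u = v ∨ length u < length v := by
  induction h with
  | refl => exact Or.inl rfl
  | tail _ hc ih =>
    obtain ⟨t, -, -, hl⟩ := hc
    rcases ih with rfl | ih <;> right <;> omega

/-- Swapping two values that are in their natural order goes up in Bruhat order. -/
theorem bruhatLE_swap_mul {u : Perm (Fin n)} {i j : Fin n} (hij : i < j) (h : u⁻¹ i < u⁻¹ j) :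
    BruhatLE u (swap i j * u) := by
  have := bruhatLE_mul_swap n u (u⁻¹ i) (u⁻¹ j) (by omega) h (by simpa using hij)
  rwa [mul_swap_eq_swap_mul, apply_inv_apply, apply_inv_apply] at this

theorem swap_mul_bruhatLE {u : Perm (Fin n)} {i j : Fin n} (hij : i < j) (h : u⁻¹ j < u⁻¹ i) :
    BruhatLE (swap i j * u) u := by
  have := bruhatLE_swap_mul (u := swap i j * u) hij (by simpa using h)
  rwa [← mul_assoc, swap_mul_self, one_mul] at this

theorem length_swap_mul_lt {u : Perm (Fin n)} {i j : Fin n} (hij : i < j)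
    (h : u⁻¹ i < u⁻¹ j) : length u < length (swap i j * u) := by
  refine (length_le_of_bruhatLE (bruhatLE_swap_mul hij h)).resolve_left fun e => ?_
  rw [eq_comm, mul_eq_right, swap_eq_one_iff] at e
  exact hij.ne e

/-- Left multiplication by `s_i` preserves the order of any two values except the pair `i`, `i'`. So
the cover is transported to an upward transposition unless it is itself left multiplication by
`s_i`. -/
theorem bruhatCover_step {v v₁ : Perm (Fin n)} (h : BruhatCover v v₁) {i i' : Fin n}
    (hi : (i' : ℕ) = i + 1) : swap i i' * v = v₁ ∨ BruhatLE (swap i i' * v) (swap i i' * v₁) := by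
  obtain ⟨t, ⟨p, q, hpq, rfl⟩, rfl, hl⟩ := h
  wlog hlt : p < q generalizing p q
  · rw [swap_comm p q] at hl ⊢
    exact this q p hpq.symm hl (lt_of_le_of_ne (not_lt.1 hlt) hpq.symm)
  have hv : v p < v q := by
    by_contra hc
    have hc : v q < v p := lt_of_le_of_ne (not_lt.1 hc) (v.injective.ne hpq.symm)
    have := bruhatLE_mul_swap n (v * swap p q) p q (by omega) hlt (by simpa using hc)
    rw [mul_assoc, swap_mul_self, mul_one] at this
    rcases length_le_of_bruhatLE this with e | e
    · rw [e] at hl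
      omega
    · omega
  by_cases hc : v p = i ∧ v q = i'
  · left
    rw [mul_swap_eq_swap_mul, hc.1, hc.2]
  · right
    rw [← mul_assoc]
    exact bruhatLE_mul_swap n _ p q (by omega) hlt (swap_adjacent_lt hi hv hc)

theorem bruhatLE_lift_left {v w : Perm (Fin n)} (h : BruhatLE v w) {i i' : Fin n}
    (hi : (i' : ℕ) = i + 1) :
    BruhatLE (swap i i' * v) w ∨ BruhatLE (swap i i' * v) (swap i i' * w) := by
  induction h using Relation.ReflTransGen.head_induction_on with
  | refl => exact Or.inr .refl
  | head hc ht ih =>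
    rcases bruhatCover_step hc hi with e | e
    · exact Or.inl (e ▸ ht)
    · exact ih.imp e.trans e.trans

theorem bruhatLE_lift_right {v w : Perm (Fin n)} (h : BruhatLE v w) {i i' : Fin n}
    (hi : (i' : ℕ) = i + 1) :
    BruhatLE v (swap i i' * w) ∨ BruhatLE (swap i i' * v) (swap i i' * w) := by
  induction h with
  | refl => exact Or.inr .refl
  | tail ht hc ih =>
    rcases bruhatCover_step hc hi with e | e
    · left
      rw [← e, ← mul_assoc, swap_mul_self, one_mul]
      exact ht
    · exact ih.imp (·.trans e) (·.trans e)

/-! ### Right weak order as containment of inversion sets -/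

theorem RightWeakCover.exists_adjacent {u v : Perm (Fin n)} (h : RightWeakCover u v) :
    ∃ k k' : Fin n, (k' : ℕ) = k + 1 ∧ u k < u k' ∧ v = u * swap k k' := by
  obtain ⟨s, ⟨k, k', hk, rfl⟩, rfl, hl⟩ := h
  refine ⟨k, k', hk, ?_, rfl⟩
  by_contra hc
  have := length_mul_swap_of_gt hk
    (lt_of_le_of_ne (not_lt.1 hc) (u.injective.ne (ne_of_adjacent hk).symm))
  omega

theorem rightWeakCover_mul_swap {u : Perm (Fin n)} {k k' : Fin n} (hk : (k' : ℕ) = k + 1)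
    (hu : u k < u k') : RightWeakCover u (u * swap k k') :=
  ⟨_, ⟨k, k', hk, rfl⟩, rfl, length_mul_swap hk hu⟩

theorem Inverts.mono {y z : Perm (Fin n)} (h : RightWeakLE y z) {i j : Fin n}
    (hy : Inverts y i j) : Inverts z i j := by
  induction h with
  | refl => exact hy
  | tail _ hc ih =>
    obtain ⟨k, k', hk, hu, rfl⟩ := hc.exists_adjacent
    exact (inverts_mul_swap hk hu i j).2 (Or.inl ih)

theorem numInv_le_of_inverts {y z : Perm (Fin n)} (h : ∀ i j, Inverts y i j → Inverts z i j) :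
    numInv y ≤ numInv z := by
  classical
  refine Finset.card_le_card fun p hp => ?_
  rw [Finset.mem_filter] at hp ⊢
  exact ⟨hp.1, h _ _ hp.2⟩

/-- The right weak order is containment of inversion sets. -/
theorem rightWeakLE_iff {y z : Perm (Fin n)} :
    RightWeakLE y z ↔ ∀ i j, Inverts y i j → Inverts z i j := by
  refine ⟨fun h i j => Inverts.mono h, fun h => ?_⟩
  induction hm : numInv z - numInv y using Nat.strong_induction_on generalizing y with
  | _ m ih =>
    by_cases hyz : z⁻¹ * y = 1
    · rw [inv_mul_eq_one.1 hyz]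
      exact .refl
    -- Neighbours in `y` that `z` puts in the opposite order. They ascend in `y`, since otherwise
    -- they would be an inversion of `y` but not of `z`; swapping them stays below `z`.
    obtain ⟨k, k', hk, hd⟩ := exists_adjacent_descent hyz
    have hkk : k < k' := by rw [Fin.lt_def]; omega
    have hlt : y k < y k' := by
      by_contra hc
      have hc : y k' < y k := lt_of_le_of_ne (not_lt.1 hc) (y.injective.ne hkk.ne')
      have := (h (y k') (y k) ⟨hc, by simpa only [inv_apply_apply] using hkk⟩).2
      exact lt_asymm hd this
    have hinv : Inverts z (y k) (y k') := ⟨hlt, hd⟩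
    have h' : ∀ i j, Inverts (y * swap k k') i j → Inverts z i j := by
      intro i j hij
      rcases (inverts_mul_swap hk hlt i j).1 hij with hij | ⟨rfl, rfl⟩
      · exact h i j hij
      · exact hinv
    have e := numInv_mul_swap hk hlt
    have e' := numInv_le_of_inverts h'
    exact (ih _ (by omega) h' rfl).head (rightWeakCover_mul_swap hk hlt)

theorem RightWeakLE.antisymm {y z : Perm (Fin n)} (h : RightWeakLE y z) (h' : RightWeakLE z y) :
    y = z := by
  have key : ∀ {a b : Perm (Fin n)}, RightWeakLE a b → a = b ∨ length a < length b := by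
    intro a b hab
    induction hab with
    | refl => exact Or.inl rfl
    | tail _ hc ih =>
      obtain ⟨_, -, -, hl⟩ := hc
      rcases ih with rfl | ih <;> right <;> omega
  rcases key h with e | e
  · exact e
  · rcases key h' with e' | e'
    · exact e'.symm
    · omega

theorem eq_of_inverts_iff {y z : Perm (Fin n)} (h : ∀ i j, Inverts y i j ↔ Inverts z i j) :
    y = z :=
  RightWeakLE.antisymm (rightWeakLE_iff.2 fun i j => (h i j).1)
    (rightWeakLE_iff.2 fun i j => (h i j).2)

/-! ### Recognizing inversion sets; joins and meets -/

/-- Every strict linear order on `Fin n` is the order of appearance in a permutation. -/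
theorem exists_perm_of_linear (r : Fin n → Fin n → Prop) (hirr : ∀ i, ¬ r i i)
    (htr : ∀ i j k, r i j → r j k → r i k) (htot : ∀ i j, i ≠ j → r i j ∨ r j i) :
    ∃ y : Perm (Fin n), ∀ i j, y⁻¹ i < y⁻¹ j ↔ r i j := by
  classical
  -- The position of `i` is the number of its predecessors.
  let f : Fin n → ℕ := fun i => (Finset.univ.filter fun j => r j i).card
  have hlt : ∀ i j, r i j → f i < f j := by
    intro i j hij
    apply Finset.card_lt_card
    refine Finset.ssubset_iff_subset_ne.2 ⟨fun a ha => ?_, fun e => ?_⟩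
    · simp only [Finset.mem_filter, Finset.mem_univ, true_and] at ha ⊢
      exact htr _ _ _ ha hij
    · have : i ∈ Finset.univ.filter fun a => r a i := by
        rw [e]
        simpa using hij
      exact hirr i (by simpa using this)
  have hfn : ∀ i, f i < n := by
    intro i
    have : (Finset.univ.filter fun j => r j i) ⊂ Finset.univ :=
      Finset.filter_ssubset.2 ⟨i, Finset.mem_univ _, hirr i⟩
    simpa using Finset.card_lt_card this
  let g : Fin n → Fin n := fun i => ⟨f i, hfn i⟩
  have hg : Function.Injective g := by
    intro i j e
    by_contra hne
    have e : f i = f j := congrArg Fin.val e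
    rcases htot i j hne with h | h
    · exact (hlt _ _ h).ne e
    · exact (hlt _ _ h).ne e.symm
  let σ : Perm (Fin n) := Equiv.ofBijective g (Finite.injective_iff_bijective.1 hg)
  refine ⟨σ⁻¹, fun i j => ?_⟩
  rw [inv_inv]
  change f i < f j ↔ r i j
  refine ⟨fun h => ?_, hlt i j⟩
  by_contra hc
  rcases eq_or_ne i j with rfl | hne
  · exact lt_irrefl _ h
  · exact lt_asymm h (hlt _ _ ((htot i j hne).resolve_left hc))

/-- Sets of pairs that are closed and co-closed are inversion sets. -/
theorem exists_perm_of_closed (I : Fin n → Fin n → Prop) (hlt : ∀ i j, I i j → i < j)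
    (hcl : ∀ i j k, I i j → I j k → I i k)
    (hco : ∀ i j k, I i k → i < j → j < k → I i j ∨ I j k) :
    ∃ y : Perm (Fin n), ∀ i j, Inverts y i j ↔ I i j := by
  obtain ⟨y, hy⟩ := exists_perm_of_linear
    (fun i j => (i < j ∧ ¬ I i j) ∨ I j i)
    (by
      rintro i (⟨h, -⟩ | h)
      · exact lt_irrefl _ h
      · exact lt_irrefl _ (hlt _ _ h))
    (by
      rintro i j k (⟨h, h'⟩ | h) (⟨g, g'⟩ | g)
      · refine Or.inl ⟨h.trans g, fun hc => ?_⟩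
        rcases hco i j k hc h g with hc | hc
        · exact h' hc
        · exact g' hc
      · rcases lt_trichotomy i k with hik | rfl | hik
        · exact Or.inl ⟨hik, fun hc => h' (hcl _ _ _ hc g)⟩
        · exact absurd g h'
        · exact Or.inr ((hco k i j g hik h).resolve_right h')
      · rcases lt_trichotomy i k with hik | rfl | hik
        · exact Or.inl ⟨hik, fun hc => g' (hcl _ _ _ h hc)⟩
        · exact absurd h g'
        · exact Or.inr ((hco j k i h g hik).resolve_left g')
      · exact Or.inr (hcl _ _ _ g h))
    (by
      intro i j hne
      rcases lt_or_gt_of_ne hne with h | h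
      · by_cases hI : I i j
        · exact Or.inr (Or.inr hI)
        · exact Or.inl (Or.inl ⟨h, hI⟩)
      · by_cases hI : I j i
        · exact Or.inl (Or.inr hI)
        · exact Or.inr (Or.inl ⟨h, hI⟩))
  refine ⟨y, fun i j => ?_⟩
  rw [Inverts, hy]
  constructor
  · rintro ⟨h, ⟨h', -⟩ | h'⟩
    · exact absurd h (lt_asymm h')
    · exact h'
  · exact fun h => ⟨hlt _ _ h, Or.inr h⟩

/-- If every step of a relation can be split at intermediate points in its transitive closure,
then so can every pair of the transitive closure. -/
theorem transGen_split {R : Fin n → Fin n → Prop}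
    (hR : ∀ i j k, R i k → i < j → j < k → Relation.TransGen R i j ∨ Relation.TransGen R j k)
    {i j k : Fin n} (h : Relation.TransGen R i k) (hij : i < j) (hjk : j < k) :
    Relation.TransGen R i j ∨ Relation.TransGen R j k := by
  induction h using Relation.TransGen.head_induction_on with
  | single h => exact hR _ _ _ h hij hjk
  | @head a c hac hck ih =>
    rcases lt_trichotomy c j with h | rfl | h
    · exact (ih h).imp_left (.head hac)
    · exact Or.inl (.single hac)
    · exact (hR _ _ _ hac hij h).imp_right (·.trans hck)

theorem Inverts.trans {y : Perm (Fin n)} {i j k : Fin n} (h : Inverts y i j)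
    (h' : Inverts y j k) : Inverts y i k :=
  ⟨h.1.trans h'.1, h'.2.trans h.2⟩

theorem Inverts.split {y : Perm (Fin n)} {i j k : Fin n} (h : Inverts y i k) (hij : i < j)
    (hjk : j < k) : Inverts y i j ∨ Inverts y j k := by
  by_contra hc
  rw [not_or, not_inverts hij, not_inverts hjk] at hc
  exact lt_asymm h.2 (hc.1.trans hc.2)

theorem transGen_lt {R : Fin n → Fin n → Prop} (hR : ∀ i j, R i j → i < j) {i j : Fin n}
    (h : Relation.TransGen R i j) : i < j := by
  induction h with
  | single h => exact hR _ _ h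
  | tail _ h ih => exact ih.trans (hR _ _ h)

/-- Joins exist in right weak order: the inversion set of the join is the transitive closure of
the union. -/
theorem exists_join (x y : Perm (Fin n)) : ∃ z : Perm (Fin n),
    IsRightWeakJoin x y z ∧ ∀ i j, Inverts z i j ↔
      Relation.TransGen (fun i j => Inverts x i j ∨ Inverts y i j) i j := by
  obtain ⟨z, hz⟩ := exists_perm_of_closed
    (Relation.TransGen fun i j => Inverts x i j ∨ Inverts y i j)
    (fun i j => transGen_lt (by rintro i j (h | h) <;> exact h.1))
    (fun i j k => Relation.TransGen.trans)
    (fun i j k h hij hjk => transGen_split (by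
      rintro i j k (h | h) hij hjk
      · exact (h.split hij hjk).imp (fun h => .single (Or.inl h)) fun h => .single (Or.inl h)
      · exact (h.split hij hjk).imp (fun h => .single (Or.inr h)) fun h => .single (Or.inr h))
      h hij hjk)
  refine ⟨z, ⟨rightWeakLE_iff.2 fun i j h => (hz i j).2 (.single (Or.inl h)),
    rightWeakLE_iff.2 fun i j h => (hz i j).2 (.single (Or.inr h)),
    fun z' hx hy => rightWeakLE_iff.2 fun i j hij => ?_⟩, hz⟩
  rw [hz] at hij
  induction hij with
  | single hs => exact hs.elim (Inverts.mono hx) (Inverts.mono hy)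
  | tail _ hs ih => exact ih.trans (hs.elim (Inverts.mono hx) (Inverts.mono hy))

/-- Meets exist in right weak order. -/
theorem exists_meet (x y : Perm (Fin n)) : ∃ z : Perm (Fin n), RightWeakLE z x ∧ RightWeakLE z y ∧
    ∀ z', RightWeakLE z' x → RightWeakLE z' y → RightWeakLE z' z := by
  -- Dually to the join, the non-inversions of the meet are the transitive closure of the union of
  -- the two sets of non-inversions.
  let R : Fin n → Fin n → Prop := fun i j => i < j ∧ (¬ Inverts x i j ∨ ¬ Inverts y i j)
  have hR : ∀ i j k, R i k → i < j → j < k →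
      Relation.TransGen R i j ∨ Relation.TransGen R j k := by
    rintro i j k ⟨-, h⟩ hij hjk
    by_contra hc
    rw [not_or] at hc
    have a : Inverts x i j ∧ Inverts y i j := by
      by_contra h'
      exact hc.1 (.single ⟨hij, by tauto⟩)
    have b : Inverts x j k ∧ Inverts y j k := by
      by_contra h'
      exact hc.2 (.single ⟨hjk, by tauto⟩)
    exact h.elim (fun h => h (a.1.trans b.1)) (fun h => h (a.2.trans b.2))
  obtain ⟨z, hz⟩ := exists_perm_of_closed (fun i j => i < j ∧ ¬ Relation.TransGen R i j)
    (fun i j h => h.1)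
    (fun i j k h h' => ⟨h.1.trans h'.1, fun hc =>
      (transGen_split hR hc h.1 h'.1).elim h.2 h'.2⟩)
    (by
      rintro i j k ⟨-, h⟩ hij hjk
      by_contra hc
      simp only [hij, hjk, true_and, not_or, not_not] at hc
      exact h (hc.1.trans hc.2))
  refine ⟨z, rightWeakLE_iff.2 fun i j h => ?_, rightWeakLE_iff.2 fun i j h => ?_,
    fun z' h h' => rightWeakLE_iff.2 fun i j hij => ?_⟩
  · by_contra hc
    exact ((hz i j).1 h).2 (.single ⟨h.1, Or.inl hc⟩)
  · by_contra hc
    exact ((hz i j).1 h).2 (.single ⟨h.1, Or.inr hc⟩)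
  · refine (hz i j).2 ⟨hij.1, fun hc => ?_⟩
    have key : z'⁻¹ i < z'⁻¹ j := by
      have hs : ∀ i j, R i j → z'⁻¹ i < z'⁻¹ j := by
        rintro i j ⟨hlt, hs⟩
        exact (not_inverts hlt).1 fun hi =>
          hs.elim (fun g => g (hi.mono h)) fun g => g (hi.mono h')
      clear hij
      induction hc with
      | single hc => exact hs _ _ hc
      | tail _ hc ih => exact ih.trans (hs _ _ hc)
    exact lt_asymm key hij.2

/-! ### Braid chambers inside the normal cones -/

theorem vec_lt_vec {y : Perm (Fin n)} {i j : Fin n} : vec y i < vec y j ↔ y⁻¹ i < y⁻¹ j := by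
  simp [vec]

theorem vec_injective : Function.Injective (vec : Perm (Fin n) → Fin n → ℝ) := by
  intro u v h
  apply inv_injective
  ext i
  have := congrFun h i
  simpa [vec] using this

theorem vec_mul (s u : Perm (Fin n)) (i : Fin n) : vec (s * u) i = vec u (s⁻¹ i) := rfl

theorem vec_mem_braidCone (y : Perm (Fin n)) : vec y ∈ braidCone y := fun _ _ h => h.le

theorem mem_normalCone {w u : Perm (Fin n)} {x : Fin n → ℝ} :
    x ∈ normalCone w u ↔ ∀ v, BruhatLE v w → x ⬝ᵥ vec v ≤ x ⬝ᵥ vec u := by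
  refine ⟨fun h v hv => h _ (subset_convexHull ℝ _ ⟨v, hv, rfl⟩), fun h p hp => ?_⟩
  have hconv : Convex ℝ {p : Fin n → ℝ | x ⬝ᵥ p ≤ x ⬝ᵥ vec u} :=
    convex_halfSpace_le (IsLinearMap.mk (dotProduct_add x) fun c p => dotProduct_smul c x p) _
  refine convexHull_min ?_ hconv hp
  rintro _ ⟨v, hv, rfl⟩
  exact h v hv

theorem dotProduct_vec_self (u v : Perm (Fin n)) : vec u ⬝ᵥ vec u = vec v ⬝ᵥ vec v := by
  have key : ∀ u : Perm (Fin n), vec u ⬝ᵥ vec u = ∑ i : Fin n, ((i : ℝ) + 1) * ((i : ℝ) + 1) :=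
    fun u => Equiv.sum_comp u⁻¹ fun i : Fin n => ((i : ℝ) + 1) * ((i : ℝ) + 1)
  rw [key, key]

/-- All the vectors `vec u` have the same norm, so this is the equality case of Cauchy–Schwarz. -/
theorem eq_of_dotProduct_vec_le {u v : Perm (Fin n)} (h : vec u ⬝ᵥ vec u ≤ vec u ⬝ᵥ vec v) :
    u = v := by
  apply vec_injective
  rw [← sub_eq_zero, ← dotProduct_self_eq_zero]
  apply le_antisymm _ (Finset.sum_nonneg fun i _ => mul_self_nonneg _)
  change (vec u - vec v) ⬝ᵥ (vec u - vec v) ≤ 0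
  rw [sub_dotProduct, dotProduct_sub, dotProduct_sub, dotProduct_comm (vec v) (vec u),
    ← dotProduct_vec_self u v]
  linarith

/-- The effect on a linear functional of swapping two coordinates. -/
theorem dotProduct_vec_swap_mul (x : Fin n → ℝ) (u : Perm (Fin n)) {i j : Fin n} (hij : i ≠ j) :
    x ⬝ᵥ vec (swap i j * u) - x ⬝ᵥ vec u = (x i - x j) * (vec u j - vec u i) := by
  rw [dotProduct, dotProduct, ← Finset.sum_sub_distrib,
    Finset.sum_eq_add i j hij]
  · simp only [vec_mul, swap_inv, swap_apply_left, swap_apply_right]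
    ring
  · rintro k - ⟨h1, h2⟩
    simp only [vec_mul, swap_inv, swap_apply_of_ne_of_ne h1 h2, sub_self]
  · simp
  · simp

theorem dotProduct_vec_swap_comp (x : Fin n → ℝ) (s u : Perm (Fin n)) :
    x ⬝ᵥ vec (s * u) = (x ∘ s) ⬝ᵥ vec u := by
  rw [dotProduct, dotProduct, ← Equiv.sum_comp s]
  simp [vec_mul]

theorem comp_mem_braidCone {x : Fin n → ℝ} {s y : Perm (Fin n)} (h : x ∈ braidCone (s * y)) :
    x ∘ s ∈ braidCone y := by
  intro i j hij
  apply h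
  simpa [vec_mul] using hij

/-- With `s = swap i i'`, every element below `s * w` is below `w` or is `s` times such an element.
On `C(y)` the maximizer `u₁` for `w` also beats the second kind: these are dominated by `s * v`,
where `v` is the maximizer for the chamber `s * y`. -/
theorem normalCone_swap_aux {w y : Perm (Fin n)} {i i' : Fin n}
    (hi : (i' : ℕ) = i + 1) (hw : w⁻¹ i < w⁻¹ i')
    (ih : ∀ y : Perm (Fin n), ∃ u, BruhatLE u w ∧ braidCone y ⊆ normalCone w u)
    (hy : y⁻¹ i < y⁻¹ i') :
    ∃ u, BruhatLE u (swap i i' * w) ∧ braidCone y ⊆ normalCone (swap i i' * w) u := by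
  have hii : i < i' := by rw [Fin.lt_def]; omega
  have hup : BruhatLE w (swap i i' * w) := bruhatLE_swap_mul hii hw
  obtain ⟨u₁, hu₁, h₁⟩ := ih y
  obtain ⟨v, hv, h₂⟩ := ih (swap i i' * y)
  refine ⟨u₁, hu₁.trans hup, fun x hx => mem_normalCone.2 fun v' hv' => ?_⟩
  -- If `i` precedes `i'` in `v`, the swap does not increase the functional, because `x i ≤ x i'`;
  -- otherwise `swap i i' * v` is already below `w`.
  have key : x ⬝ᵥ vec (swap i i' * v) ≤ x ⬝ᵥ vec u₁ := by
    rcases lt_or_gt_of_ne (v⁻¹.injective.ne hii.ne) with h | h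
    · have e := dotProduct_vec_swap_mul x v hii.ne
      have e1 := mem_normalCone.1 (h₁ hx) v hv
      have e2 := hx i i' (vec_lt_vec.2 hy)
      have e3 := vec_lt_vec.2 h
      nlinarith
    · exact mem_normalCone.1 (h₁ hx) _ ((swap_mul_bruhatLE hii h).trans hv)
  rcases bruhatLE_lift_right hv' hi with h | h
  · rw [← mul_assoc, swap_mul_self, one_mul] at h
    exact mem_normalCone.1 (h₁ hx) _ h
  · rw [← mul_assoc (swap i i') (swap i i') w, swap_mul_self, one_mul] at h
    refine le_trans ?_ key
    have hx' : x ∘ swap i i' ∈ braidCone (swap i i' * y) := by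
      apply comp_mem_braidCone
      rwa [← mul_assoc, swap_mul_self, one_mul]
    have := mem_normalCone.1 (h₂ hx') _ h
    rwa [← dotProduct_vec_swap_comp, ← dotProduct_vec_swap_comp, ← mul_assoc, swap_mul_self,
      one_mul] at this

theorem bruhatLE_swap_mul_of_ascent {w v : Perm (Fin n)} {i i' : Fin n} (hi : (i' : ℕ) = i + 1)
    (hw : w⁻¹ i < w⁻¹ i') (hv : BruhatLE v (swap i i' * w)) :
    BruhatLE (swap i i' * v) (swap i i' * w) := by
  have hii : i < i' := by rw [Fin.lt_def]; omega
  rcases bruhatLE_lift_left hv hi with h | h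
  · exact h
  · rw [← mul_assoc (swap i i') (swap i i') w, swap_mul_self, one_mul] at h
    exact h.trans (bruhatLE_swap_mul hii hw)

/-- Each chamber of the braid fan lies in a maximal cone of the normal fan of `Q_w`. -/
theorem exists_braidCone_subset (w : Perm (Fin n)) : ∀ y : Perm (Fin n),
    ∃ u, BruhatLE u w ∧ braidCone y ⊆ normalCone w u := by
  induction hm : length w using Nat.strong_induction_on generalizing w with
  | _ m ih =>
    by_cases hw : w = 1
    · subst hw
      refine fun y => ⟨1, .refl, fun x _ => mem_normalCone.2 fun v hv => ?_⟩
      rcases length_le_of_bruhatLE hv with rfl | h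
      · exact le_rfl
      · rw [length_eq_numInv 1, numInv_one] at h
        omega
    obtain ⟨i, i', hi, hd⟩ := exists_adjacent_descent (inv_ne_one.2 hw)
    have hii : i < i' := by rw [Fin.lt_def]; omega
    have hw' : (swap i i' * w)⁻¹ i < (swap i i' * w)⁻¹ i' := by
      simpa using hd
    have hlt := length_swap_mul_lt hii hw'
    have hss : swap i i' * (swap i i' * w) = w := by
      rw [← mul_assoc, swap_mul_self, one_mul]
    rw [hss] at hlt
    have ih := ih _ (hm ▸ hlt) (swap i i' * w) rfl
    intro y
    rcases lt_or_gt_of_ne (y⁻¹.injective.ne hii.ne) with hy | hy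
    · have := normalCone_swap_aux hi hw' ih hy
      rwa [hss] at this
    -- The interval `[e, w]` is stable under left multiplication by `swap i i'`, so the chamber with
    -- `i'` before `i` follows by reflection.
    · obtain ⟨u, hu, h⟩ := normalCone_swap_aux (y := swap i i' * y) hi hw' ih (by simpa using hy)
      have hinv : ∀ v, BruhatLE v w → BruhatLE (swap i i' * v) w := fun v hv => by
        have := bruhatLE_swap_mul_of_ascent (v := v) hi hw' (by rwa [hss])
        rwa [hss] at this
      rw [hss] at hu h
      refine ⟨swap i i' * u, hinv u hu, fun x hx => mem_normalCone.2 fun v hv => ?_⟩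
      have hx' : x ∘ swap i i' ∈ braidCone (swap i i' * y) := by
        apply comp_mem_braidCone
        rwa [← mul_assoc, swap_mul_self, one_mul]
      have := mem_normalCone.1 (h hx') _ (hinv v hv)
      rwa [← dotProduct_vec_swap_comp, ← dotProduct_vec_swap_comp, ← mul_assoc, swap_mul_self,
        one_mul] at this

/-- The indicator vector of the values at positions `≥ m` of `y`. -/
def upperIndicator (y : Perm (Fin n)) (m : ℕ) : Fin n → ℝ :=
  fun i => if m ≤ (y⁻¹ i : ℕ) then 1 else 0

theorem upperIndicator_mem_braidCone (y : Perm (Fin n)) (m : ℕ) :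
    upperIndicator y m ∈ braidCone y := by
  intro i j hij
  rw [vec_lt_vec, Fin.lt_def] at hij
  unfold upperIndicator
  split_ifs
  · exact le_rfl
  · omega
  · exact zero_le_one
  · exact le_rfl

theorem upperIndicator_mul_swap (y : Perm (Fin n)) {k k' : Fin n} (hk : (k' : ℕ) = k + 1)
    {m : ℕ} (hm : m ≠ k') : upperIndicator (y * swap k k') m = upperIndicator y m := by
  ext i
  have : (m ≤ ((y * swap k k')⁻¹ i : Fin n)) ↔ m ≤ (y⁻¹ i : Fin n) := by
    rw [mul_inv_rev, swap_inv, Perm.mul_apply, swap_apply_def]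
    split_ifs with h1 h2
    · rw [h1]; omega
    · rw [h2]; omega
    · rfl
  simp only [upperIndicator, this]

/-- Differences of vectors of the chamber recover every coordinate, which expresses that the chamber
is full-dimensional. -/
theorem upperIndicator_sub (y : Perm (Fin n)) (p : Fin n) (v : Fin n → ℝ) :
    upperIndicator y p ⬝ᵥ v - upperIndicator y (p + 1) ⬝ᵥ v = v (y p) := by
  rw [← sub_dotProduct, dotProduct, Finset.sum_eq_single (y p)]
  · simp [upperIndicator]
  · intro i _ hi
    have : (y⁻¹ i : ℕ) ≠ p := fun e => hi (by rw [← Fin.ext e, apply_inv_apply])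
    have : (p : ℕ) ≤ (y⁻¹ i : ℕ) ↔ (p : ℕ) + 1 ≤ (y⁻¹ i : ℕ) := by omega
    simp [upperIndicator, -Perm.coe_inv, this]
  · simp

/-- The vertex attached to a chamber is unique. -/
theorem eq_of_braidCone_subset {w u v y : Perm (Fin n)} (hu : BruhatLE u w) (hv : BruhatLE v w)
    (h : braidCone y ⊆ normalCone w u) (h' : braidCone y ⊆ normalCone w v) : u = v := by
  have key : ∀ x ∈ braidCone y, x ⬝ᵥ vec u = x ⬝ᵥ vec v := fun x hx =>
    le_antisymm (mem_normalCone.1 (h' hx) u hu) (mem_normalCone.1 (h hx) v hv)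
  apply vec_injective
  ext i
  rw [← apply_inv_apply y i, ← upperIndicator_sub y _ (vec u), ← upperIndicator_sub y _ (vec v),
    key _ (upperIndicator_mem_braidCone y _), key _ (upperIndicator_mem_braidCone y _)]

theorem eq_or_eq_swap_mul {u v : Perm (Fin n)} {a b : Fin n}
    (h : ∀ i, i ≠ a → i ≠ b → u⁻¹ i = v⁻¹ i) : v = u ∨ v = swap a b * u := by
  have h' : ∀ i, i ≠ a → i ≠ b → (v * u⁻¹) i = i := by
    intro i ha hb
    rw [Perm.mul_apply, h i ha hb, apply_inv_apply]
  by_cases ha : (v * u⁻¹) a = a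
  · left
    rw [← mul_inv_eq_one]
    ext i
    by_cases hia : i = a
    · subst hia
      rw [ha]; rfl
    by_cases hib : i = b
    · subst hib
      by_contra hc
      have hc : (v * u⁻¹) i ≠ i := fun e => hc (by rw [e]; rfl)
      by_cases hca : (v * u⁻¹) i = a
      · exact hia ((v * u⁻¹).injective (hca.trans ha.symm))
      · exact hc ((v * u⁻¹).injective (h' _ hca hc))
    · rw [h' i hia hib]; rfl
  · right
    have hab : (v * u⁻¹) a = b := by
      by_contra hc
      exact ha ((v * u⁻¹).injective (h' _ ha hc))
    have hba : (v * u⁻¹) b = a := by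
      obtain ⟨c, hc⟩ := (v * u⁻¹).surjective a
      by_cases hca : c = a
      · exact absurd (hca ▸ hc) ha
      by_cases hcb : c = b
      · rwa [hcb] at hc
      · exact absurd ((h' c hca hcb).symm.trans hc) hca
    rw [← mul_inv_eq_iff_eq_mul]
    ext i
    congr 1
    by_cases hia : i = a
    · rw [hia, hab, swap_apply_left]
    by_cases hib : i = b
    · rw [hib, hba, swap_apply_right]
    · rw [h' i hia hib, swap_apply_of_ne_of_ne hia hib]

/-- Crossing a wall of the braid fan either keeps the vertex of `Q_w` or swaps the two
coordinates of the wall. -/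
theorem wall_crossing {w u v y : Perm (Fin n)} (hu : BruhatLE u w) (hv : BruhatLE v w)
    {k k' : Fin n} (hk : (k' : ℕ) = k + 1) (h : braidCone y ⊆ normalCone w u)
    (h' : braidCone (y * swap k k') ⊆ normalCone w v) :
    v = u ∨ (v = swap (y k) (y k') * u ∧ u⁻¹ (y k) < u⁻¹ (y k')) := by
  have hkk : k < k' := by rw [Fin.lt_def]; omega
  have hne : y k ≠ y k' := y.injective.ne hkk.ne
  -- The indicators with `m ≠ k'` lie in both chambers, hence on the wall. Their differences give
  -- every coordinate except those at `y k` and `y k'`.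
  have key : ∀ m : ℕ, m ≠ k' → upperIndicator y m ⬝ᵥ vec u = upperIndicator y m ⬝ᵥ vec v :=
    fun m hm => by
      have h1 := h (upperIndicator_mem_braidCone y m)
      have h2 := h' (upperIndicator_mem_braidCone _ m)
      rw [upperIndicator_mul_swap y hk hm] at h2
      exact le_antisymm (mem_normalCone.1 h2 u hu) (mem_normalCone.1 h1 v hv)
  have hoff : ∀ i, i ≠ y k → i ≠ y k' → u⁻¹ i = v⁻¹ i := by
    intro i hi hi'
    have e1 : (y⁻¹ i : ℕ) ≠ k := fun e => hi (by rw [← Fin.ext e, apply_inv_apply])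
    have e2 : (y⁻¹ i : ℕ) ≠ k' := fun e => hi' (by rw [← Fin.ext e, apply_inv_apply])
    have : vec u i = vec v i := by
      rw [← apply_inv_apply y i, ← upperIndicator_sub y _ (vec u), ← upperIndicator_sub y _ (vec v),
        key _ e2, key _ (by omega)]
    ext
    simpa [vec] using this
  rcases eq_or_eq_swap_mul hoff with e | e
  · exact Or.inl e
  · refine Or.inr ⟨e, ?_⟩
    have h1 := mem_normalCone.1 (h (vec_mem_braidCone y)) v hv
    have h2 := dotProduct_vec_swap_mul (vec y) u hne
    rw [← e] at h2
    have h3 : vec y (y k) < vec y (y k') := by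
      rw [vec_lt_vec, inv_apply_apply, inv_apply_apply]; exact hkk
    by_contra hc
    have hc : u⁻¹ (y k') < u⁻¹ (y k) := lt_of_le_of_ne (not_lt.1 hc) (u⁻¹.injective.ne hne.symm)
    rw [← vec_lt_vec] at hc
    nlinarith

/-! ### Classes as sets of linear extensions -/

/-- The generating relations of the poset whose linear extensions form the class of `u`. -/
def Step (w u : Perm (Fin n)) (i j : Fin n) : Prop :=
  u⁻¹ i < u⁻¹ j ∧ BruhatLE (swap i j * u) w

theorem Step.ne {w u : Perm (Fin n)} {i j : Fin n} (h : Step w u i j) : i ≠ j := by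
  rintro rfl
  exact lt_irrefl _ h.1

theorem Inverts.step {w u : Perm (Fin n)} (hu : BruhatLE u w) {i j : Fin n}
    (h : Inverts u i j) : Step w u j i :=
  ⟨h.2, by rw [swap_comm]; exact (swap_mul_bruhatLE h.1 h.2).trans hu⟩

theorem Step.le_of_mem_normalCone {w u : Perm (Fin n)} {i j : Fin n} (h : Step w u i j)
    {x : Fin n → ℝ} (hx : x ∈ normalCone w u) : x i ≤ x j := by
  have h1 := mem_normalCone.1 hx _ h.2
  have h2 := dotProduct_vec_swap_mul x u h.ne
  have h3 := vec_lt_vec.2 h.1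
  by_contra hc
  nlinarith

/-- The chambers in the normal cone at `vec u` are the linear extensions of `Step w u`. -/
theorem braidCone_subset_iff {w u y : Perm (Fin n)} (hu : BruhatLE u w) :
    braidCone y ⊆ normalCone w u ↔ ∀ i j, Step w u i j → y⁻¹ i < y⁻¹ j := by
  constructor
  · intro h i j hs
    have := hs.le_of_mem_normalCone (h (vec_mem_braidCone y))
    refine lt_of_le_of_ne ?_ (y⁻¹.injective.ne hs.ne)
    simpa only [vec_lt_vec, not_lt] using this.not_gt
  · intro h
    have hle : RightWeakLE u y := rightWeakLE_iff.2 fun i j hij => ⟨hij.1, h _ _ (hij.step hu)⟩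
    -- Climb from `u` to `y` in weak order. If a wall changed the vertex, the two values swapped
    -- there would form a step at `u` that `y` inverts.
    have key : ∀ z, RightWeakLE u z → RightWeakLE z y → braidCone z ⊆ normalCone w u := by
      intro z hz
      induction hz with
      | refl =>
        intro _ x hx
        obtain ⟨v, hv, hsub⟩ := exists_braidCone_subset w u
        rw [eq_of_dotProduct_vec_le (mem_normalCone.1 (hsub (vec_mem_braidCone u)) u hu)]
        exact hsub hx
      | @tail z z' huz hc ih =>
        intro hzy
        have ih := ih (hzy.head hc)
        obtain ⟨k, k', hk, hlt, rfl⟩ := hc.exists_adjacent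
        obtain ⟨v, hv, hsub⟩ := exists_braidCone_subset w (z * swap k k')
        rcases wall_crossing hu hv hk ih hsub with rfl | ⟨rfl, hlt'⟩
        · exact hsub
        · have hinv := ((inverts_mul_swap hk hlt _ _).2 (Or.inr ⟨rfl, rfl⟩)).mono hzy
          exact absurd (h _ _ ⟨hlt', hv⟩) (lt_asymm hinv.2)
    exact key y hle .refl

theorem self_braidCone_subset {w u : Perm (Fin n)} (hu : BruhatLE u w) :
    braidCone u ⊆ normalCone w u :=
  (braidCone_subset_iff hu).2 fun _ _ h => h.1

/-- The strict partial order on `{1, …, n}` generated by `Step w u`. -/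
def StepOrder (w u : Perm (Fin n)) : Fin n → Fin n → Prop :=
  Relation.TransGen (Step w u)

theorem StepOrder.lt {w u y : Perm (Fin n)} (hu : BruhatLE u w)
    (hy : braidCone y ⊆ normalCone w u) {i j : Fin n} (h : StepOrder w u i j) :
    y⁻¹ i < y⁻¹ j := by
  rw [braidCone_subset_iff hu] at hy
  induction h with
  | single h => exact hy _ _ h
  | tail _ h ih => exact ih.trans (hy _ _ h)

theorem swap_swap_mul {i j k : Fin n} (u : Perm (Fin n)) (hjk : j ≠ k) (hik : i ≠ k) :
    swap i k * (swap i j * u) = swap i j * (swap j k * u) := by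
  rw [← mul_assoc, swap_mul_swap_rotate hjk hik, mul_assoc]

/-- A step over an intermediate value that is also intermediate in position splits. -/
theorem Step.split_between {w u : Perm (Fin n)} {i j k : Fin n} (h : Step w u i k)
    (hij : i < j) (hjk : j < k) (h1 : u⁻¹ i < u⁻¹ j) (h2 : u⁻¹ j < u⁻¹ k) :
    Step w u i j ∧ Step w u j k := by
  have hik := hij.trans hjk
  have ei : (swap i j)⁻¹ k = k := by rw [swap_inv, swap_apply_of_ne_of_ne hik.ne' hjk.ne']
  have e2 : (swap j k)⁻¹ i = i := by rw [swap_inv, swap_apply_of_ne_of_ne hij.ne hik.ne]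
  constructor
  · refine ⟨h1, ?_⟩
    have a : BruhatLE (swap i j * u) (swap j k * (swap i j * u)) := by
      apply bruhatLE_swap_mul hjk
      rw [mul_inv_rev, Perm.mul_apply, Perm.mul_apply, ei, swap_inv, swap_apply_right]
      exact h.1
    have b : BruhatLE (swap j k * (swap i j * u)) (swap i j * (swap j k * (swap i j * u))) := by
      apply bruhatLE_swap_mul hij
      simp only [mul_inv_rev, Perm.mul_apply, e2]
      simp only [swap_inv, swap_apply_left, swap_apply_of_ne_of_ne hik.ne' hjk.ne']
      exact h2
    rw [← swap_swap_mul _ hjk.ne hik.ne, ← mul_assoc (swap i j), swap_mul_self, one_mul] at b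
    exact (a.trans b).trans h.2
  · refine ⟨h2, ?_⟩
    have a : BruhatLE (swap j k * u) (swap i j * (swap j k * u)) := by
      apply bruhatLE_swap_mul hij
      rw [mul_inv_rev, Perm.mul_apply, Perm.mul_apply, e2, swap_inv, swap_apply_left]
      exact h.1
    rw [← swap_swap_mul _ hjk.ne hik.ne] at a
    have b : BruhatLE (swap i k * (swap i j * u)) (swap j k * (swap i k * (swap i j * u))) := by
      apply bruhatLE_swap_mul hjk
      have e3 : swap i k j = j := swap_apply_of_ne_of_ne hij.ne' hjk.ne
      simp only [mul_inv_rev, Perm.mul_apply, swap_inv, e3, swap_apply_right, swap_apply_left]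
      exact h1
    have e : swap j k * (swap i k * (swap i j * u)) = swap i k * u := by
      rw [swap_swap_mul _ hjk.ne hik.ne, swap_comm j k, swap_comm i j,
        ← swap_swap_mul _ hij.ne' hik.ne', ← mul_assoc (swap k j), swap_mul_self, one_mul,
        swap_comm k i]
    rw [e] at b
    exact (a.trans b).trans h.2

/-- If `j` is not between `i` and `k` in position, then it forms an inversion of `u` with one of
them; this inversion is a reversed step, which is composed with the given one. -/
theorem Step.split {w u : Perm (Fin n)} (hu : BruhatLE u w) {i j k : Fin n} (h : Step w u i k)
    (hij : i < j) (hjk : j < k) : StepOrder w u i j ∨ StepOrder w u j k := by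
  rcases lt_or_gt_of_ne (u⁻¹.injective.ne hij.ne) with h1 | h1
  · rcases lt_or_gt_of_ne (u⁻¹.injective.ne hjk.ne) with h2 | h2
    · exact Or.inl (.single (h.split_between hij hjk h1 h2).1)
    · have : Inverts u j k := ⟨hjk, h2⟩
      exact Or.inl (.tail (.single h) (this.step hu))
  · have : Inverts u i j := ⟨hij, h1⟩
    exact Or.inr (.head (this.step hu) (.single h))

/-- The class of `u` has a greatest element, with an explicit inversion set. -/
theorem exists_top {w u : Perm (Fin n)} (hu : BruhatLE u w) :
    ∃ t : Perm (Fin n), braidCone t ⊆ normalCone w u ∧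
      ∀ i j, Inverts t i j ↔ i < j ∧ ¬ StepOrder w u i j := by
  obtain ⟨t, ht⟩ := exists_perm_of_closed (fun i j => i < j ∧ ¬ StepOrder w u i j)
    (fun i j h => h.1)
    -- Closure is the splitting property of `StepOrder`; co-closure is its transitivity.
    (fun i j k h h' => ⟨h.1.trans h'.1, fun hc =>
      (transGen_split (fun _ _ _ h => h.split hu) hc h.1 h'.1).elim h.2 h'.2⟩)
    (by
      rintro i j k ⟨-, h⟩ hij hjk
      by_contra hc
      simp only [hij, hjk, true_and, not_or, not_not] at hc
      exact h (hc.1.trans hc.2))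
  refine ⟨t, (braidCone_subset_iff hu).2 fun i j h => ?_, ht⟩
  rcases lt_or_gt_of_ne h.ne with hij | hij
  · rw [← not_inverts hij, ht]
    exact fun hc => hc.2 (.single h)
  · refine ((ht j i).2 ⟨hij, fun hc => ?_⟩).2
    exact lt_irrefl _ (StepOrder.lt hu (self_braidCone_subset hu) (hc.tail h))

theorem rightWeakLE_of_braidCone_subset {w u y : Perm (Fin n)} (hu : BruhatLE u w)
    (hy : braidCone y ⊆ normalCone w u) : RightWeakLE u y :=
  rightWeakLE_iff.2 fun _ _ h => ⟨h.1, (braidCone_subset_iff hu).1 hy _ _ (h.step hu)⟩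

theorem rightWeakLE_top {w u y t : Perm (Fin n)} (hu : BruhatLE u w)
    (hy : braidCone y ⊆ normalCone w u)
    (ht : ∀ i j, Inverts t i j ↔ i < j ∧ ¬ StepOrder w u i j) : RightWeakLE y t :=
  rightWeakLE_iff.2 fun i j h =>
    (ht i j).2 ⟨h.1, fun hc => lt_asymm h.2 (StepOrder.lt hu hy hc)⟩

/-! ### Edges of the polytope and walls of the braid fan -/

/-- A permutation sorting a family of keys, with ties kept in their natural order. -/
theorem exists_sort {α : Type*} [LinearOrder α] (f : Fin n → α) :
    ∃ y : Perm (Fin n), ∀ i j, Inverts y i j ↔ i < j ∧ f j < f i :=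
  exists_perm_of_closed (fun i j => i < j ∧ f j < f i) (fun _ _ h => h.1)
    (fun _ _ _ h h' => ⟨h.1.trans h'.1, h'.2.trans h.2⟩)
    (by
      rintro i j k ⟨-, h⟩ hij hjk
      rcases lt_or_ge (f j) (f i) with h' | h'
      · exact Or.inl ⟨hij, h'⟩
      · exact Or.inr ⟨hjk, h.trans_le h'⟩)

theorem mem_braidCone_iff {y : Perm (Fin n)} {x : Fin n → ℝ} :
    x ∈ braidCone y ↔ ∀ i j, i < j →
      (Inverts y i j → x j ≤ x i) ∧ (¬ Inverts y i j → x i ≤ x j) := by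
  constructor
  · intro h i j hij
    exact ⟨fun hi => h _ _ (vec_lt_vec.2 hi.2),
      fun hi => h _ _ (vec_lt_vec.2 ((not_inverts hij).1 hi))⟩
  · intro h i j hij
    rw [vec_lt_vec] at hij
    rcases lt_trichotomy i j with hlt | rfl | hlt
    · exact (h i j hlt).2 ((not_inverts hlt).2 hij)
    · exact le_rfl
    · exact (h j i hlt).1 ⟨hlt, hij⟩

/-- A normal cone is covered by the chambers that it contains. -/
theorem exists_chamber {w u : Perm (Fin n)} (hu : BruhatLE u w) {x : Fin n → ℝ}
    (hx : x ∈ normalCone w u) : ∃ y : Perm (Fin n), x ∈ braidCone y ∧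
      braidCone y ⊆ normalCone w u ∧ ∀ i j, i < j → x j < x i → Inverts y i j := by
  -- Ties of `x` are broken by position in `u`: `x` increases weakly along steps, so the result
  -- extends `Step w u`.
  obtain ⟨y, hy⟩ := exists_sort fun i => toLex (x i, u⁻¹ i)
  simp only [Prod.Lex.toLex_lt_toLex] at hy
  refine ⟨y, mem_braidCone_iff.2 fun i j hij => ⟨fun h => ?_, fun h => ?_⟩, ?_,
    fun i j hij h => (hy i j).2 ⟨hij, Or.inl h⟩⟩
  · rcases ((hy i j).1 h).2 with h | h
    · exact h.le
    · exact h.1.le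
  · by_contra hc
    exact h ((hy i j).2 ⟨hij, Or.inl (not_le.1 hc)⟩)
  · refine (braidCone_subset_iff hu).2 fun i j h => ?_
    have hle := h.le_of_mem_normalCone hx
    rcases lt_or_gt_of_ne h.ne with hij | hij
    · rw [← not_inverts hij, hy]
      rintro ⟨-, h' | h'⟩
      · exact absurd hle (not_le.2 h')
      · exact lt_asymm h'.2 h.1
    · refine ((hy j i).2 ⟨hij, ?_⟩).2
      rcases hle.lt_or_eq with h' | h'
      · exact Or.inl h'
      · exact Or.inr ⟨h', h.1⟩

theorem normalCone_eq_of_dotProduct_eq {w u v : Perm (Fin n)} {x : Fin n → ℝ}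
    (hx : x ∈ normalCone w u) (h : x ⬝ᵥ vec u = x ⬝ᵥ vec v) : x ∈ normalCone w v :=
  mem_normalCone.2 fun p hp => h ▸ mem_normalCone.1 hx p hp

/-- A linear functional that is maximized on the vertices of `Q_w` exactly at `vec u` and `vec v`
exposes the segment between them. -/
theorem isExposed_segment {w u v : Perm (Fin n)} (hu : BruhatLE u w) (hv : BruhatLE v w)
    {x : Fin n → ℝ} (hxu : x ∈ normalCone w u) (hxv : x ∈ normalCone w v)
    (h : ∀ u', BruhatLE u' w → x ∈ normalCone w u' → u' = u ∨ u' = v) :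
    IsExposed ℝ (polytope w) (segment ℝ (vec u) (vec v)) := by
  intro _
  let l : StrongDual ℝ (Fin n → ℝ) := ∑ i, x i • ContinuousLinearMap.proj i
  have hl : ∀ p, l p = x ⬝ᵥ p := fun p => by simp [l, dotProduct]
  have huv : x ⬝ᵥ vec u = x ⬝ᵥ vec v :=
    le_antisymm (mem_normalCone.1 hxv u hu) (mem_normalCone.1 hxu v hv)
  have hseg : ∀ p ∈ segment ℝ (vec u) (vec v), x ⬝ᵥ p = x ⬝ᵥ vec u := by
    rintro _ ⟨a, b, -, -, hab, rfl⟩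
    rw [dotProduct_add, dotProduct_smul, dotProduct_smul, ← huv, ← add_smul, hab, one_smul]
  -- This set contains all vertices, hence `Q_w`, so a maximizer must lie in the segment.
  have hconv : Convex ℝ {p : Fin n → ℝ | x ⬝ᵥ p < x ⬝ᵥ vec u ∨ p ∈ segment ℝ (vec u) (vec v)} := by
    have hle : ∀ p, x ⬝ᵥ p < x ⬝ᵥ vec u ∨ p ∈ segment ℝ (vec u) (vec v) →
        x ⬝ᵥ p ≤ x ⬝ᵥ vec u := fun p hp => hp.elim le_of_lt fun hp => (hseg p hp).le
    rw [convex_iff_forall_pos]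
    intro p hp q hq a b ha hb hab
    have hp' := hle p hp
    have hq' := hle q hq
    have hM : x ⬝ᵥ vec u = a * (x ⬝ᵥ vec u) + b * (x ⬝ᵥ vec u) := by rw [← add_mul, hab, one_mul]
    rcases hp with hp | hp
    · left
      rw [dotProduct_add, dotProduct_smul, dotProduct_smul, smul_eq_mul, smul_eq_mul]
      nlinarith
    rcases hq with hq | hq
    · left
      rw [dotProduct_add, dotProduct_smul, dotProduct_smul, smul_eq_mul, smul_eq_mul]
      nlinarith
    · exact Or.inr (convex_segment _ _ hp hq ha.le hb.le hab)
  have hsub : polytope w ⊆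
      {p : Fin n → ℝ | x ⬝ᵥ p < x ⬝ᵥ vec u ∨ p ∈ segment ℝ (vec u) (vec v)} := by
    refine convexHull_min ?_ hconv
    rintro _ ⟨u', hu', rfl⟩
    rcases (mem_normalCone.1 hxu u' hu').lt_or_eq with hlt | heq
    · exact Or.inl hlt
    · right
      rcases h u' hu' (normalCone_eq_of_dotProduct_eq hxu heq.symm) with rfl | rfl
      · exact left_mem_segment _ _ _
      · exact right_mem_segment _ _ _
  have hmem : ∀ u', BruhatLE u' w → vec u' ∈ polytope w :=
    fun u' hu' => subset_convexHull ℝ _ ⟨u', hu', rfl⟩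
  refine ⟨l, Set.Subset.antisymm (fun p hp => ⟨?_, fun q hq => ?_⟩) fun p hp => ?_⟩
  · exact (convex_convexHull ℝ _).segment_subset (hmem u hu) (hmem v hv) hp
  · rw [hl, hl, hseg p hp]
    exact hxu q hq
  · refine (hsub hp.1).resolve_left fun hlt => ?_
    have := hp.2 _ (hmem u hu)
    rw [hl, hl] at this
    exact absurd hlt (not_lt.2 this)

theorem eq_or_eq_of_vec_mem_segment {u v u' : Perm (Fin n)}
    (h : vec u' ∈ segment ℝ (vec u) (vec v)) : u' = u ∨ u' = v := by
  obtain ⟨a, b, ha, hb, hab, he⟩ := h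
  by_contra! hc
  have h1 : vec u' ⬝ᵥ vec u < vec u' ⬝ᵥ vec u' :=
    not_le.1 fun h => hc.1 (eq_of_dotProduct_vec_le h)
  have h2 : vec u' ⬝ᵥ vec v < vec u' ⬝ᵥ vec u' :=
    not_le.1 fun h => hc.2 (eq_of_dotProduct_vec_le h)
  have h3 : vec u' ⬝ᵥ vec u' = a * (vec u' ⬝ᵥ vec u) + b * (vec u' ⬝ᵥ vec v) := by
    nth_rewrite 2 [← he]
    rw [dotProduct_add, dotProduct_smul, dotProduct_smul, smul_eq_mul, smul_eq_mul]
  have hb' : b = 1 - a := by linarith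
  subst hb'
  rcases ha.lt_or_eq with ha | rfl <;> nlinarith

/-- An edge of `Q_w` is exposed by a vector whose maximizers among the vertices are the two end
points. -/
theorem HasEdge.exists_vector {w u v : Perm (Fin n)}
    (h : HasEdge w u v) : ∃ x : Fin n → ℝ, x ∈ normalCone w u ∧ x ∈ normalCone w v ∧
      ∀ u', BruhatLE u' w → x ∈ normalCone w u' → u' = u ∨ u' = v := by
  obtain ⟨l, hl⟩ := h.2 ⟨_, left_mem_segment ℝ _ _⟩
  let x : Fin n → ℝ := fun i => l (Pi.single i 1)
  have hx : ∀ p, x ⬝ᵥ p = l p := fun p => by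
    conv_rhs => rw [← Finset.univ_sum_single p]
    rw [map_sum, dotProduct]
    refine Finset.sum_congr rfl fun i _ => ?_
    have : (Pi.single i (p i) : Fin n → ℝ) = p i • Pi.single i 1 := by
      rw [← Pi.single_smul, smul_eq_mul, mul_one]
    rw [this, map_smul, smul_eq_mul, mul_comm]
  have hu : vec u ∈ segment ℝ (vec u) (vec v) := left_mem_segment _ _ _
  have hv : vec v ∈ segment ℝ (vec u) (vec v) := right_mem_segment _ _ _
  rw [hl] at hu hv
  refine ⟨x, fun p hp => ?_, fun p hp => ?_, fun u' hu' hmax => ?_⟩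
  · rw [hx, hx]
    exact hu.2 p hp
  · rw [hx, hx]
    exact hv.2 p hp
  · apply eq_or_eq_of_vec_mem_segment
    rw [hl]
    refine ⟨subset_convexHull ℝ _ ⟨u', hu', rfl⟩, fun q hq => ?_⟩
    rw [← hx, ← hx]
    exact hmax q hq

/-- Crossing a wall of the braid fan upwards between two different normal cones is an upwards
directed edge of `Q_w`. -/
theorem hasEdge_of_wall {w u v y : Perm (Fin n)} (hu : BruhatLE u w) (hv : BruhatLE v w)
    {k k' : Fin n} (hk : (k' : ℕ) = k + 1) (hy : y k < y k')
    (h : braidCone y ⊆ normalCone w u) (h' : braidCone (y * swap k k') ⊆ normalCone w v)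
    (hne : v ≠ u) : HasEdge w u v ∧ length u < length v := by
  obtain ⟨hvu, hlt⟩ := (wall_crossing hu hv hk h h').resolve_left hne
  refine ⟨⟨fun e => hne (vec_injective e).symm, ?_⟩, hvu ▸ length_swap_mul_lt hy hlt⟩
  have hkk : k < k' := by rw [Fin.lt_def]; omega
  have hinv := inverts_mul_swap (u := y) hk hy
  have hvec : vec (y * swap k k') = vec (swap (y k) (y k') * y) := by rw [mul_swap_eq_swap_mul]
  -- A point in the relative interior of the wall: only the two adjacent chambers contain it.
  let x : Fin n → ℝ := vec y + vec (y * swap k k')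
  have hxab : x (y k) = x (y k') := by
    simp only [x, hvec, Pi.add_apply, vec_mul, swap_inv, swap_apply_left, swap_apply_right]
    ring
  have hx1 : ∀ i j, Inverts y i j → x j < x i := fun i j hij =>
    add_lt_add (vec_lt_vec.2 hij.2) (vec_lt_vec.2 ((hinv i j).2 (Or.inl hij)).2)
  have hx2 : ∀ i j, i < j → ¬ Inverts (y * swap k k') i j → x i < x j := fun i j hij hni =>
    add_lt_add (vec_lt_vec.2 ((not_inverts hij).1 fun hc => hni ((hinv i j).2 (Or.inl hc))))
      (vec_lt_vec.2 ((not_inverts hij).1 hni))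
  have hxy : x ∈ braidCone y := mem_braidCone_iff.2 fun i j hij =>
    ⟨fun hi => (hx1 i j hi).le, fun hi => by
      by_cases hi' : Inverts (y * swap k k') i j
      · obtain ⟨rfl, rfl⟩ := ((hinv i j).1 hi').resolve_left hi
        exact hxab.le
      · exact (hx2 i j hij hi').le⟩
  have hxy' : x ∈ braidCone (y * swap k k') := mem_braidCone_iff.2 fun i j hij =>
    ⟨fun hi => by
      rcases (hinv i j).1 hi with hi | ⟨rfl, rfl⟩
      · exact (hx1 i j hi).le
      · exact hxab.ge, fun hi => (hx2 i j hij hi).le⟩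
  refine isExposed_segment hu hv (h hxy) (h' hxy') fun u' hu' hx' => ?_
  obtain ⟨y', hxy'', hsub, -⟩ := exists_chamber hu' hx'
  rw [mem_braidCone_iff] at hxy''
  have hge : ∀ i j, Inverts y i j → Inverts y' i j := fun i j hij => by
    by_contra hc
    exact absurd ((hxy'' i j hij.1).2 hc) (not_le.2 (hx1 i j hij))
  have hle : ∀ i j, Inverts y' i j → Inverts (y * swap k k') i j := fun i j hij => by
    by_contra hc
    exact absurd ((hxy'' i j hij.1).1 hij) (not_le.2 (hx2 i j hij.1 hc))
  by_cases hab : Inverts y' (y k) (y k')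
  · right
    have : y' = y * swap k k' := eq_of_inverts_iff fun i j => ⟨hle i j, fun hi => by
      rcases (hinv i j).1 hi with hi | ⟨rfl, rfl⟩
      · exact hge i j hi
      · exact hab⟩
    exact eq_of_braidCone_subset hu' hv hsub (this ▸ h')
  · left
    have : y' = y := eq_of_inverts_iff fun i j => ⟨fun hi => by
      rcases (hinv i j).1 (hle i j hi) with hi' | ⟨rfl, rfl⟩
      · exact hi'
      · exact absurd hi hab, hge i j⟩
    exact eq_of_braidCone_subset hu' hu hsub (this ▸ h)

/-- Along a chain in weak order whose chambers belong to `u` or to `v`, starting at `u` and ending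
at `v ≠ u`, some wall separates the normal cones at `u` and at `v`. -/
theorem exists_wall_of_chain {w u v y z : Perm (Fin n)} (hvu : v ≠ u) (hv : BruhatLE v w)
    (hu : BruhatLE u w) (hyz : RightWeakLE y z)
    (hy : braidCone y ⊆ normalCone w u) (hz : braidCone z ⊆ normalCone w v)
    (hmid : ∀ y', RightWeakLE y y' → RightWeakLE y' z →
      braidCone y' ⊆ normalCone w u ∨ braidCone y' ⊆ normalCone w v) :
    ∃ (y : Perm (Fin n)) (k k' : Fin n), (k' : ℕ) = k + 1 ∧ y k < y k' ∧
      braidCone y ⊆ normalCone w u ∧ braidCone (y * swap k k') ⊆ normalCone w v := by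
  induction hyz using Relation.ReflTransGen.head_induction_on with
  | refl => exact absurd (eq_of_braidCone_subset hv hu hz hy) hvu
  | @head y y₁ hc ht ih =>
    rcases hmid y₁ (.single hc) ht with h | h
    · exact ih h fun y' h1 h2 => hmid y' (h1.head hc) h2
    · obtain ⟨k, k', hk, hlt, rfl⟩ := hc.exists_adjacent
      exact ⟨y, k, k', hk, hlt, hy, h⟩

/-- Every upwards directed edge of `Q_w` comes from crossing a wall of the braid fan upwards. -/
theorem exists_wall_of_hasEdge {w u v : Perm (Fin n)} (hu : BruhatLE u w) (hv : BruhatLE v w)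
    (h : HasEdge w u v) (hl : length u < length v) :
    ∃ (y : Perm (Fin n)) (k k' : Fin n), (k' : ℕ) = k + 1 ∧ y k < y k' ∧
      braidCone y ⊆ normalCone w u ∧ braidCone (y * swap k k') ⊆ normalCone w v := by
  have hne : u ≠ v := fun e => hl.ne (congrArg length e)
  obtain ⟨x, hxu, hxv, hx⟩ := h.exists_vector
  -- The least chamber containing `x`. All chambers between it and another chamber containing `x`
  -- contain `x` too, hence belong to `u` or `v`.
  obtain ⟨y₀, hy₀⟩ := exists_sort x
  have hxy₀ : x ∈ braidCone y₀ := mem_braidCone_iff.2 fun i j hij =>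
    ⟨fun hi => ((hy₀ i j).1 hi).2.le, fun hi => not_lt.1 fun hc => hi ((hy₀ i j).2 ⟨hij, hc⟩)⟩
  have hcone : ∀ y, x ∈ braidCone y →
      braidCone y ⊆ normalCone w u ∨ braidCone y ⊆ normalCone w v := fun y hy => by
    obtain ⟨u', hu', hsub⟩ := exists_braidCone_subset w y
    rcases hx u' hu' (hsub hy) with rfl | rfl
    · exact Or.inl hsub
    · exact Or.inr hsub
  have hmid : ∀ y z, x ∈ braidCone z → RightWeakLE y₀ y → RightWeakLE y z → x ∈ braidCone y := by
    intro y z hxz h1 h2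
    rw [mem_braidCone_iff] at hxz hxy₀ ⊢
    exact fun i j hij => ⟨fun hi => (hxz i j hij).1 (hi.mono h2),
      fun hi => (hxy₀ i j hij).2 fun hc => hi (hc.mono h1)⟩
  rcases hcone y₀ hxy₀ with h₀ | h₀
  · obtain ⟨z, hxz, hz, hinv⟩ := exists_chamber hv hxv
    have hle : RightWeakLE y₀ z := rightWeakLE_iff.2 fun i j hij =>
      hinv i j hij.1 ((hy₀ i j).1 hij).2
    exact exists_wall_of_chain hne.symm hv hu hle h₀ hz fun y' h1 h2 =>
      hcone y' (hmid y' z hxz h1 h2)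
  -- Starting in the cone of `v` would give an edge directed from `v` up to `u`, against the
  -- lengths.
  · obtain ⟨z, hxz, hz, hinv⟩ := exists_chamber hu hxu
    have hle : RightWeakLE y₀ z := rightWeakLE_iff.2 fun i j hij =>
      hinv i j hij.1 ((hy₀ i j).1 hij).2
    obtain ⟨y, k, k', hk, hlt, h1, h2⟩ := exists_wall_of_chain hne hu hv hle h₀ hz
      fun y' h1 h2 => (hcone y' (hmid y' z hxz h1 h2)).symm
    exact absurd (hasEdge_of_wall hv hu hk hlt h1 h2 hne).2 (lt_asymm hl)

/-! ### Monotonicity of the class maxima along an edge -/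

/-- To see that `swap i j * u` is below `w`, it suffices that one upward swap of values leads from
it to some `p` below `w`. -/
theorem step_of_swap {w u p : Perm (Fin n)} {i j c d : Fin n} (hp : BruhatLE p w)
    (he : p = swap c d * (swap i j * u)) (hcd : c < d) (h : u⁻¹ i < u⁻¹ j)
    (h' : u⁻¹ (swap i j c) < u⁻¹ (swap i j d)) : Step w u i j := by
  refine ⟨h, (bruhatLE_swap_mul hcd ?_).trans (he ▸ hp)⟩
  simpa only [mul_inv_rev, Perm.mul_apply, swap_inv] using h'

section Edge

variable {w u : Perm (Fin n)} {a b : Fin n}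

theorem step_swap_apply {i j : Fin n} (h : Step w (swap a b * u) i j) :
    u⁻¹ (swap a b i) < u⁻¹ (swap a b j) := by
  simpa only [mul_inv_rev, Perm.mul_apply, swap_inv] using h.1

theorem step_of_step_swap_disjoint {i j : Fin n} (hab : a < b) (huab : u⁻¹ a < u⁻¹ b)
    (h : Step w (swap a b * u) i j) (hia : i ≠ a) (hib : i ≠ b) (hja : j ≠ a) (hjb : j ≠ b) :
    Step w u i j := by
  have h1 := step_swap_apply h
  rw [swap_apply_of_ne_of_ne hia hib, swap_apply_of_ne_of_ne hja hjb] at h1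
  refine step_of_swap h.2 (c := a) (d := b) ?_ hab h1 ?_
  · rw [← mul_assoc, mul_swap_eq_swap_mul, swap_apply_of_ne_of_ne hia.symm hja.symm,
      swap_apply_of_ne_of_ne hib.symm hjb.symm, mul_assoc]
  · rwa [swap_apply_of_ne_of_ne hia.symm hja.symm, swap_apply_of_ne_of_ne hib.symm hjb.symm]

theorem step_right_of_step_swap {k : Fin n} (hab : a < b) (hbk : b < k) (huab : u⁻¹ a < u⁻¹ b)
    (h : Step w (swap a b * u) a k) : Step w u b k := by
  have hak := hab.trans hbk
  have h1 := step_swap_apply h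
  rw [swap_apply_left, swap_apply_of_ne_of_ne hak.ne' hbk.ne'] at h1
  refine step_of_swap h.2 (swap_swap_mul u hbk.ne hak.ne) hab h1 ?_
  rw [swap_apply_of_ne_of_ne hab.ne hak.ne, swap_apply_left]
  exact huab.trans h1

theorem step_left_of_step_swap {i : Fin n} (hab : a < b) (hia : i < a) (huab : u⁻¹ a < u⁻¹ b)
    (h : Step w (swap a b * u) i b) : Step w u i a := by
  have hib := hia.trans hab
  have h1 := step_swap_apply h
  rw [swap_apply_right, swap_apply_of_ne_of_ne hia.ne hib.ne] at h1
  refine step_of_swap h.2 (c := a) (d := b) ?_ hab h1 ?_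
  · rw [swap_comm i b, swap_comm a b, swap_swap_mul u hia.ne' hib.ne', swap_comm a i]
  · rw [swap_apply_right, swap_apply_of_ne_of_ne hib.ne' hab.ne']
    exact h1.trans huab

/-- Along an edge of `Q_w` from `u` up to `swap a b * u`, the upwards steps at the upper end hold
at the lower end. -/
theorem stepOrder_of_step_swap {i j : Fin n} (hu : BruhatLE u w) (hab : a < b)
    (huab : u⁻¹ a < u⁻¹ b) (hv : BruhatLE (swap a b * u) w)
    (hbet : ∀ c, StepOrder w u a c → ¬ StepOrder w u c b) (hij : i < j)
    (h : Step w (swap a b * u) i j) : StepOrder w u i j := by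
  have hs : Step w u a b := ⟨huab, hv⟩
  have h1 := step_swap_apply h
  by_cases hia : i = a
  · subst hia
    rcases lt_trichotomy j b with hjb | rfl | hjb
    · rw [swap_apply_left, swap_apply_of_ne_of_ne hij.ne' hjb.ne] at h1
      refine .single (step_of_swap h.2 (c := j) (d := b) ?_ hjb (huab.trans h1) ?_)
      · rw [swap_comm i j, swap_swap_mul u hab.ne hjb.ne]
      · rwa [swap_apply_right, swap_apply_of_ne_of_ne hab.ne' hjb.ne']
    · rw [swap_apply_left, swap_apply_right] at h1
      exact absurd huab (lt_asymm h1)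
    · exact .tail (.single hs) (step_right_of_step_swap hab hjb huab h)
  by_cases hjb : j = b
  · subst hjb
    rcases lt_or_gt_of_ne hia with hia | hia
    · exact .tail (.single (step_left_of_step_swap hab hia huab h)) hs
    · rw [swap_apply_right, swap_apply_of_ne_of_ne hia.ne' hij.ne] at h1
      refine .single (step_of_swap h.2 (c := a) (d := i) ?_ hia (h1.trans huab) ?_)
      · rw [swap_comm a i, swap_swap_mul u hab.ne' hia.ne', swap_comm a j]
      · rwa [swap_apply_left, swap_apply_of_ne_of_ne hia.ne hab.ne]
  by_cases hja : j = a
  · subst hja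
    have hib := hij.trans hab
    rw [swap_apply_left, swap_apply_of_ne_of_ne hij.ne hib.ne] at h1
    rcases lt_or_gt_of_ne (u⁻¹.injective.ne hij.ne) with h2 | h2
    · refine .single (step_of_swap h.2 (swap_swap_mul u hab.ne hib.ne).symm hib h2 ?_)
      rwa [swap_apply_left, swap_apply_of_ne_of_ne hib.ne' hab.ne']
    -- Here `i` would lie strictly between `a` and `b` in the step order, which `hbet` forbids.
    · have s1 : Step w u j i := Inverts.step hu ⟨hij, h2⟩
      have s2 : Step w u i b := by
        refine step_of_swap h.2 (c := j) (d := b) ?_ hab h1 ?_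
        · rw [swap_comm i j, swap_swap_mul u hib.ne' hij.ne', swap_comm b i]
        · rwa [swap_apply_right, swap_apply_of_ne_of_ne hij.ne' hab.ne]
      exact absurd (.single s2) (hbet i (.single s1))
  by_cases hib : i = b
  · subst hib
    have haj := hab.trans hij
    rw [swap_apply_right, swap_apply_of_ne_of_ne haj.ne' hij.ne'] at h1
    rcases lt_or_gt_of_ne (u⁻¹.injective.ne hij.ne) with h2 | h2
    · refine .single (step_of_swap h.2 (c := a) (d := j) ?_ haj h2 ?_)
      · rw [swap_comm i j, swap_comm a i, ← swap_swap_mul u hab.ne' haj.ne', swap_comm j a]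
      · rwa [swap_apply_right, swap_apply_of_ne_of_ne hab.ne haj.ne]
    · have s1 : Step w u j i := Inverts.step hu ⟨hij, h2⟩
      have s2 : Step w u a j := by
        refine step_of_swap h.2 (c := a) (d := i) ?_ hab h1 ?_
        · rw [swap_comm a i, swap_swap_mul u haj.ne hij.ne]
        · rwa [swap_apply_left, swap_apply_of_ne_of_ne hab.ne' hij.ne]
      exact absurd (.single s1) (hbet j (.single s2))
  exact .single (step_of_step_swap_disjoint hab huab h hia hib hja hjb)

/-- The greatest elements of the classes at the two ends of an edge are comparable. -/
theorem exists_rightWeakLE_of_wall {y t : Perm (Fin n)} {k k' : Fin n} (hu : BruhatLE u w)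
    (hv : BruhatLE (swap (y k) (y k') * u) w) (huab : u⁻¹ (y k) < u⁻¹ (y k'))
    (hk : (k' : ℕ) = k + 1) (hy : y k < y k') (h : braidCone y ⊆ normalCone w u)
    (h' : braidCone (y * swap k k') ⊆ normalCone w (swap (y k) (y k') * u))
    (ht : ∀ i j, Inverts t i j ↔ i < j ∧ ¬ StepOrder w u i j) :
    ∃ z, braidCone z ⊆ normalCone w (swap (y k) (y k') * u) ∧ RightWeakLE t z := by
  -- The two values are neighbours in `y`, a linear extension of the step order at `u`.
  have hbet : ∀ c, StepOrder w u (y k) c → ¬ StepOrder w u c (y k') := fun c h1 h2 => by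
    have h1 := StepOrder.lt hu h h1
    have h2 := StepOrder.lt hu h h2
    rw [inv_apply_apply, Fin.lt_def] at h1 h2
    omega
  obtain ⟨z, ⟨htz, -, -⟩, hz⟩ := exists_join t (y * swap k k')
  refine ⟨z, (braidCone_subset_iff hv).2 fun i j hs => ?_, htz⟩
  rcases lt_or_gt_of_ne hs.ne with hij | hij
  swap
  · have : Inverts (swap (y k) (y k') * u) j i := ⟨hij, hs.1⟩
    exact ((hz j i).2 (.single (Or.inr
      (this.mono (rightWeakLE_of_braidCone_subset hv h'))))).2
  rw [← not_inverts hij, hz]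
  intro hc
  have hyt : ∀ {i j}, Inverts y i j → Inverts t i j := Inverts.mono (rightWeakLE_top hu h ht)
  -- The inversions of `t` are transitive, and an increasing chain uses the only other pair `(y k, y
  -- k')` at most once.
  have key : Inverts t i j ∨
      ((i = y k ∨ Inverts t i (y k)) ∧ (j = y k' ∨ Inverts t (y k') j)) := by
    clear hij hs
    induction hc with
    | single hs =>
      rw [inverts_mul_swap hk hy] at hs
      rcases hs with hs | hs | hs
      · exact Or.inl hs
      · exact Or.inl (hyt hs)
      · exact Or.inr ⟨Or.inl hs.1, Or.inl hs.2⟩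
    | @tail c d _ hs ih =>
      rw [inverts_mul_swap hk hy] at hs
      have hs : Inverts t c d ∨ (c = y k ∧ d = y k') := by
        rcases hs with hs | hs | hs
        · exact Or.inl hs
        · exact Or.inl (hyt hs)
        · exact Or.inr hs
      rcases hs with hs | ⟨rfl, rfl⟩
      · rcases ih with ih | ⟨ih1, rfl | ih2⟩
        · exact Or.inl (ih.trans hs)
        · exact Or.inr ⟨ih1, Or.inr hs⟩
        · exact Or.inr ⟨ih1, Or.inr (ih2.trans hs)⟩
      · rcases ih with ih | ⟨ih1, ih2 | ih2⟩
        · exact Or.inr ⟨Or.inr ih, Or.inl rfl⟩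
        · exact absurd ih2 hy.ne
        · exact absurd ih2.1 (lt_asymm hy)
  rcases key with key | ⟨rfl | hi, rfl | hj⟩
  · exact ((ht i j).1 key).2 (stepOrder_of_step_swap hu hy huab hv hbet hij hs)
  · have := step_swap_apply hs
    rw [swap_apply_left, swap_apply_right] at this
    exact lt_asymm this huab
  · exact ((ht _ _).1 hj).2 (.single (step_right_of_step_swap hy hj.1 huab hs))
  · exact ((ht _ _).1 hi).2 (.single (step_left_of_step_swap hy hi.1 huab hs))
  -- Now `i < y k < y k' < j`. As `i` is not forced before `y k`, nor `y k'` before `j`, the step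
  -- from `i` to `j` yields steps from `y k` to `i` and from `j` to `y k'`, so `i` lies between the
  -- two neighbours.
  · obtain ⟨hia, hi⟩ := (ht _ _).1 hi
    obtain ⟨hbj, hj⟩ := (ht _ _).1 hj
    have haj := hy.trans hbj
    have hib := hia.trans hy
    have hs' : Step w u i j := step_of_step_swap_disjoint hy huab hs hia.ne hib.ne haj.ne' hbj.ne'
    have s1 : Step w u (y k) i := by
      rcases lt_or_gt_of_ne (u⁻¹.injective.ne hia.ne) with h1 | h1
      · rcases lt_or_gt_of_ne (u⁻¹.injective.ne haj.ne) with h2 | h2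
        · exact absurd (.single (hs'.split_between hia haj h1 h2).1) hi
        · exact absurd (.tail (.single hs') (Inverts.step hu ⟨haj, h2⟩)) hi
      · exact Inverts.step hu ⟨hia, h1⟩
    have s2 : Step w u j (y k') := by
      rcases lt_or_gt_of_ne (u⁻¹.injective.ne hbj.ne) with h1 | h1
      · rcases lt_or_gt_of_ne (u⁻¹.injective.ne hib.ne) with h2 | h2
        · exact absurd (.single (hs'.split_between hib hbj h2 h1).2) hj
        · exact absurd (.head (Inverts.step hu ⟨hib, h2⟩) (.single hs')) hj
      · exact Inverts.step hu ⟨hbj, h1⟩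
    exact hbet i (.single s1) (.head hs' (.single s2))

end Edge

/-! ### The vertex map and the lattice structure -/

/-- The element of `[e, w]` in the class of `y`. -/
theorem exists_vertex (w y : Perm (Fin n)) :
    ∃ u : SkeletonPoset w, braidCone y ⊆ normalCone w u.1 :=
  let ⟨u, hu, h⟩ := exists_braidCone_subset w y
  ⟨⟨u, hu⟩, h⟩

/-- The vertex of `Q_w` whose normal cone contains the chamber of `y`. -/
noncomputable def vertex (w y : Perm (Fin n)) : SkeletonPoset w :=
  (exists_vertex w y).choose

theorem braidCone_subset_vertex (w y : Perm (Fin n)) :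
    braidCone y ⊆ normalCone w (vertex w y).1 :=
  (exists_vertex w y).choose_spec

theorem vertex_eq_iff {w y : Perm (Fin n)} {u : SkeletonPoset w} :
    vertex w y = u ↔ braidCone y ⊆ normalCone w u.1 :=
  ⟨fun h => h ▸ braidCone_subset_vertex w y, fun h => Subtype.ext
    (eq_of_braidCone_subset (vertex w y).2 u.2 (braidCone_subset_vertex w y) h)⟩

theorem theta_iff {w y z : Perm (Fin n)} : Theta w y z ↔ vertex w y = vertex w z := by
  constructor
  · intro h
    exact (vertex_eq_iff.2 ((h _ (vertex w y).2).1 (braidCone_subset_vertex w y))).symm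
  · intro h u hu
    rw [← vertex_eq_iff (u := ⟨u, hu⟩), ← vertex_eq_iff (u := ⟨u, hu⟩), h]

theorem vertex_self {w : Perm (Fin n)} (u : SkeletonPoset w) : vertex w u.1 = u :=
  vertex_eq_iff.2 (self_braidCone_subset u.2)

theorem isBot_vertex (w x : Perm (Fin n)) : IsBot w x (vertex w x).1 :=
  ⟨theta_iff.2 (vertex_self _).symm, fun _ hy => rightWeakLE_of_braidCone_subset (vertex w x).2
    (vertex_eq_iff.1 (theta_iff.1 hy).symm)⟩

theorem isBot_bot (w x : Perm (Fin n)) : IsBot w x (Bot w x) :=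
  Classical.epsilon_spec ⟨_, isBot_vertex w x⟩

theorem bot_eq_vertex (w x : Perm (Fin n)) : Bot w x = (vertex w x).1 :=
  RightWeakLE.antisymm ((isBot_bot w x).2 _ (isBot_vertex w x).1)
    ((isBot_vertex w x).2 _ (isBot_bot w x).1)

theorem isTop_top (w x : Perm (Fin n)) : IsTop w x (Top w x) := by
  obtain ⟨t, ht, hinv⟩ := exists_top (vertex w x).2
  exact Classical.epsilon_spec (p := IsTop w x) ⟨t, theta_iff.2 (vertex_eq_iff.2 ht).symm,
    fun y hy => rightWeakLE_top (vertex w x).2 (vertex_eq_iff.1 (theta_iff.1 hy).symm) hinv⟩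

theorem isRightWeakJoin_rightWeakJoin (x y : Perm (Fin n)) :
    IsRightWeakJoin x y (rightWeakJoin x y) :=
  let ⟨z, hz, _⟩ := exists_join x y
  Classical.epsilon_spec ⟨z, hz⟩

theorem vertex_top {w : Perm (Fin n)} (u : SkeletonPoset w) : vertex w (Top w u.1) = u :=
  (theta_iff.1 (isTop_top w u.1).1).symm.trans (vertex_self u)

/-- A weak order cover crosses one wall, which either stays in a normal cone or gives an upward
edge. -/
theorem vertex_mono {w y z : Perm (Fin n)} (h : RightWeakLE y z) : vertex w y ≤ vertex w z := by
  induction h with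
  | refl => exact le_rfl
  | @tail b c _ hc ih =>
    refine ih.trans ?_
    obtain ⟨k, k', hk, hlt, rfl⟩ := hc.exists_adjacent
    by_cases hne : vertex w (b * swap k k') = vertex w b
    · exact hne.ge
    · exact Relation.ReflTransGen.single (hasEdge_of_wall (vertex w b).2 (vertex w _).2 hk hlt
        (braidCone_subset_vertex w b) (braidCone_subset_vertex w _) fun e => hne (Subtype.ext e))

/-- Each generating edge crosses a wall, where some element of the upper class lies above the
maximum of the lower one. -/
theorem top_mono {w : Perm (Fin n)} {u v : SkeletonPoset w} (h : u ≤ v) :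
    RightWeakLE (Top w u.1) (Top w v.1) := by
  change Relation.ReflTransGen (SkeletonCover w) u v at h
  induction h with
  | refl => exact .refl
  | @tail b c _ hc ih =>
    refine ih.trans ?_
    obtain ⟨y, k, k', hk, hlt, hy, hy'⟩ := exists_wall_of_hasEdge b.2 c.2 hc.1 hc.2
    have hne : c.1 ≠ b.1 := fun e => hc.2.ne (congrArg length e).symm
    obtain ⟨hcb, huab⟩ := (wall_crossing b.2 c.2 hk hy hy').resolve_left hne
    obtain ⟨t, ht, hinv⟩ := exists_top b.2
    have hc' := c.2
    rw [hcb] at hc' hy'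
    obtain ⟨z, hz, htz⟩ := exists_rightWeakLE_of_wall b.2 hc' huab hk hlt hy hy' hinv
    rw [← hcb] at hz
    have h1 : RightWeakLE (Top w b.1) t := rightWeakLE_top b.2 (vertex_eq_iff.1 (vertex_top b)) hinv
    have h2 : RightWeakLE z (Top w c.1) := (isTop_top w c.1).2 z
      (theta_iff.2 ((vertex_self c).trans (vertex_eq_iff.2 hz).symm))
    exact (h1.trans htz).trans h2

/-- The `1`-skeleton poset is a lattice; `vertex w` is left adjoint to `Top w`. -/
@[reducible]
noncomputable def skeletonLattice (w : Perm (Fin n)) : Lattice (SkeletonPoset w) :=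
  { skeletonPartialOrder w with
    sup := fun u v => vertex w (rightWeakJoin (Top w u.1) (Top w v.1))
    le_sup_left := fun u v => by
      conv_lhs => rw [← vertex_top u]
      exact vertex_mono (isRightWeakJoin_rightWeakJoin _ _).1
    le_sup_right := fun u v => by
      conv_lhs => rw [← vertex_top v]
      exact vertex_mono (isRightWeakJoin_rightWeakJoin _ _).2.1
    sup_le := fun u v z hu hv => by
      rw [← vertex_top z]
      exact vertex_mono ((isRightWeakJoin_rightWeakJoin _ _).2.2 _ (top_mono hu) (top_mono hv))
    inf := fun u v => vertex w (exists_meet (Top w u.1) (Top w v.1)).choose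
    inf_le_left := fun u v => by
      conv_rhs => rw [← vertex_top u]
      exact vertex_mono (exists_meet _ _).choose_spec.1
    inf_le_right := fun u v => by
      conv_rhs => rw [← vertex_top v]
      exact vertex_mono (exists_meet _ _).choose_spec.2.1
    le_inf := fun z u v hu hv => by
      rw [← vertex_top z]
      exact vertex_mono ((exists_meet _ _).choose_spec.2.2 _ (top_mono hu) (top_mono hv)) }

end BruhatPolytope

open BruhatPolytope in
/-- The first three conjuncts say that `Bot_w`, `Top_w` and `∨_R` exist, so that the formula for
the join is about the intended permutations. -/
theorem theorem4p4 (n : ℕ) (w : Equiv.Perm (Fin n)) :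
    (∀ x : Equiv.Perm (Fin n), IsBot w x (Bot w x)) ∧
    (∀ x : Equiv.Perm (Fin n), IsTop w x (Top w x)) ∧
    (∀ x y : Equiv.Perm (Fin n), IsRightWeakJoin x y (rightWeakJoin x y)) ∧
    ∃ L : Lattice (SkeletonPoset w),
      L.toPartialOrder = skeletonPartialOrder w ∧
      ∀ u v : SkeletonPoset w,
        (u ⊔ v).1 = Bot w (rightWeakJoin (Top w u.1) (Top w v.1)) := by
  exact ⟨isBot_bot w, isTop_top w, isRightWeakJoin_rightWeakJoin, skeletonLattice w, rfl,
      fun _ _ => (bot_eq_vertex w _).symm⟩
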